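/- Fix an integer $p\ge 2$ and let $\mathcal S^{p-1}$ be the unit sphere of $\mathbb R^p$. Let $f:\mathbb R\to\mathbb R^+$ be strictly increasing, differentiable at $0$ with $f(0)=f'(0)=1$, and twice differentiable at $0$. For $\boldsymbol\theta\in\mathcal S^{p-1}$ and $\kappa>0$, let $\mathrm P^{(n)}_{\boldsymbol\theta,\kappa,f}$ be the hypothesis under which $\mathbf X_{n1},\dots,\mathbf X_{nn}$ are independent with common density proportional to $\mathbf x\mapsto f(\kappa\,\mathbf x'\boldsymbol\theta)$ with respect to the surface area measure on $\mathcal S^{p-1}$, and let $\mathrm P^{(n)}_0$ be the hypothesis under which they are independent and uniform on $\mathcal S^{p-1}$. For $\boldsymbol\mu=\kappa\boldsymbol\theta\ne\mathbf 0$ put $\mathrm P^{(n)}_{\boldsymbol\mu,f}:=\mathrm P^{(n)}_{\boldsymbol\theta,\kappa,f}$, and put $\mathrm P^{(n)}_{\mathbf 0,f}:=\mathrm P^{(n)}_0$. Let $\bar{\mathbf X}_n=\frac1n\sum_{i=1}^n\mathbf X_{ni}$ and $\boldsymbol\Delta^{(n)}:=\sqrt{np}\,\bar{\mathbf X}_n$.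 (i) For every sequence $(\boldsymbol\tau_n)$ in $\mathbb R^p$ that is $O(1)$ but not $o(1)$, with $\boldsymbol\mu_n=\sqrt{p/n}\,\boldsymbol\tau_n$, one has, as $n\to\infty$ under $\mathrm P_0^{(n)}$, $$\log\frac{d\mathrm P^{(n)}_{\boldsymbol\mu_n,f}}{d\mathrm P^{(n)}_0}=\boldsymbol\tau_n'\boldsymbol\Delta^{(n)}-\tfrac12\|\boldsymbol\tau_n\|^2+o_{\mathrm P}(1).$$ (ii) Under $\mathrm P_0^{(n)}$, $\boldsymbol\Delta^{(n)}$ converges in distribution to the standard $p$-variate normal distribution. (iii) For every $\alpha\in(0,1)$, the low-dimensional Rayleigh test $\phi_n^{\mathrm R}$, which rejects uniformity whenever $np\|\bar{\mathbf X}_n\|^2>\Psi_p^{-1}(1-\alpha)$, with $\Psi_p$ the distribution function of the $\chi^2_p$ distribution, is locally asymptotically maximin at asymptotic level $\alpha$. That is, $\limsup_n\mathrm E_{\mathrm P_0^{(n)}}[\phi_n^{\mathrm R}]\le\alpha$ and, for every $c>0$, every set $A$ with $\{\boldsymbol\tau\in\mathbb R^p:\|\boldsymbol\tau\|=c\}\subseteq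 A\subseteq\{\boldsymbol\tau\in\mathbb R^p:\|\boldsymbol\tau\|\ge c\}$ and every sequence $(\psi_n)$ of (possibly randomized) tests with $\limsup_n\mathrm E_{\mathrm P_0^{(n)}}[\psi_n]\le\alpha$, $$\limsup_{n\to\infty}\ \inf_{\boldsymbol\tau\in A}\mathrm E_{\mathrm P^{(n)}_{\sqrt{p/n}\,\boldsymbol\tau,f}}[\psi_n]\ \le\ \liminf_{n\to\infty}\ \inf_{\boldsymbol\tau\in A}\mathrm E_{\mathrm P^{(n)}_{\sqrt{p/n}\,\boldsymbol\tau,f}}[\phi_n^{\mathrm R}].$$ -/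

import Mathlib

open MeasureTheory ProbabilityTheory Filter Asymptotics
open scoped Topology ENNReal RealInnerProductSpace

noncomputable section

namespace SphereUniformity

/-- `ℝ^p` with its Euclidean structure. -/
abbrev Vec (p : ℕ) : Type := EuclideanSpace ℝ (Fin p)

/-- The unit sphere `S^{p-1}` of `ℝ^p`. -/
abbrev Sph (p : ℕ) : Type := Metric.sphere (0 : Vec p) 1

/-- A sample `(X_1, …, X_n)` of points of `S^{p-1}`. -/
abbrev Sample (p n : ℕ) : Type := Fin n → Sph p

/-- The angular functions `f : ℝ → ℝ⁺`: strictly increasing, differentiable at `0`,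
with `f 0 = f' 0 = 1`. -/
structure IsAngularFunction (f : ℝ → ℝ) : Prop where
  nonneg : ∀ x, 0 ≤ f x
  strictMono : StrictMono f
  map_zero : f 0 = 1
  hasDerivAt_zero : HasDerivAt f 1 0

/-- `f` is twice differentiable at `x`: it is differentiable near `x` and its derivative is
differentiable at `x`. -/
def TwiceDifferentiableAt (f : ℝ → ℝ) (x : ℝ) : Prop :=
  (∀ᶠ y in 𝓝 x, DifferentiableAt ℝ f y) ∧ DifferentiableAt ℝ (deriv f) x

/-- The surface area measure on `S^{p-1}`. -/
def surfaceMeasure (p : ℕ) : Measure (Sph p) := (volume : Measure (Vec p)).toSphere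

/-- The uniform distribution on `S^{p-1}`. -/
def uniformSphere (p : ℕ) : Measure (Sph p) :=
  (surfaceMeasure p Set.univ)⁻¹ • surfaceMeasure p

/-- The normalizing constant `c` that makes `x ↦ c * f (κ x'θ)` a probability density with respect
to the surface area measure. -/
def normConst (p : ℕ) (θ : Vec p) (κ : ℝ) (f : ℝ → ℝ) : ℝ :=
  (∫ x : Sph p, f (κ * ⟪(x : Vec p), θ⟫) ∂(surfaceMeasure p))⁻¹

/-- The rotationally symmetric distribution on `S^{p-1}` with density `x ↦ c * f (κ x'θ)` with
respect to the surface area measure; `θ` is meant to be a unit vector (and is irrelevant when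
`κ = 0`). -/
def rotSym (p : ℕ) (θ : Vec p) (κ : ℝ) (f : ℝ → ℝ) : Measure (Sph p) :=
  (surfaceMeasure p).withDensity
    (fun x => ENNReal.ofReal (normConst p θ κ f * f (κ * ⟪(x : Vec p), θ⟫)))

/-- The null hypothesis `P_0^{(n)}`: the observations are i.i.d. uniform on `S^{p-1}`. -/
def nullLaw (p n : ℕ) : Measure (Sample p n) := Measure.pi fun _ => uniformSphere p

/-- The hypothesis `P^{(n)}_{θ,κ,f}`: the observations are i.i.d. with density
`x ↦ c * f (κ x'θ)`. -/
def sampleLaw (p n : ℕ) (θ : Vec p) (κ : ℝ) (f : ℝ → ℝ) : Measure (Sample p n) :=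
  Measure.pi fun _ => rotSym p θ κ f

/-- The reparametrized hypothesis `P^{(n)}_{μ,f} = P^{(n)}_{θ,κ,f}`, where `μ = κ θ` with
`κ = ‖μ‖` and `θ = μ / ‖μ‖`. For `μ = 0` it is the null hypothesis, since then `κ = 0`. -/
def muLaw (p n : ℕ) (μ : Vec p) (f : ℝ → ℝ) : Measure (Sample p n) :=
  sampleLaw p n (‖μ‖⁻¹ • μ) ‖μ‖ f

/-- The local alternative `P^{(n)}_{μ,f}` with `μ = √(p/n) τ`. -/
def localLaw (p n : ℕ) (f : ℝ → ℝ) (τ : Vec p) : Measure (Sample p n) :=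
  muLaw p n (√((p : ℝ) / n) • τ) f

/-- The sample mean `X̄_n`. -/
def sampleMean (p n : ℕ) (x : Sample p n) : Vec p := (n : ℝ)⁻¹ • ∑ i, (x i : Vec p)

/-- The central sequence `Δ^{(n)} = √(n p) X̄_n`. -/
def centralSeq (p n : ℕ) (x : Sample p n) : Vec p := √((n : ℝ) * p) • sampleMean p n x

/-- `Y_n = o_P(1)` under `P_n`, the probability space being allowed to vary with `n`. -/
def IsLittleOP {Ω : ℕ → Type*} [∀ n, MeasurableSpace (Ω n)] (P : ∀ n, Measure (Ω n))
    (Y : ∀ n, Ω n → ℝ) : Prop :=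
  ∀ ε : ℝ, 0 < ε → Tendsto (fun n => P n {x | ε ≤ |Y n x|}) atTop (𝓝 0)

/-- A (possibly randomized) test: a measurable function with values in `[0,1]`, the probability
of rejecting the null hypothesis given the data. -/
structure IsTest {Ω : Type*} [MeasurableSpace Ω] (φ : Ω → ℝ) : Prop where
  measurable : Measurable φ
  nonneg : ∀ x, 0 ≤ φ x
  le_one : ∀ x, φ x ≤ 1

/-- `(φ_n)` is a sequence of tests of asymptotic level `α` for the null hypotheses `P_n`. -/
def HasAsymptoticLevel {Ω : ℕ → Type*} [∀ n, MeasurableSpace (Ω n)] (P : ∀ n, Measure (Ω n))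
    (α : ℝ) (φ : ∀ n, Ω n → ℝ) : Prop :=
  (∀ n, IsTest (φ n)) ∧ limsup (fun n => ∫ x, φ n x ∂(P n)) atTop ≤ α

/-- The minimal power of the test `φ` over the alternatives `Q τ`, `τ ∈ A`. -/
def minPower {Ω E : Type*} [MeasurableSpace Ω] (Q : E → Measure Ω) (A : Set E)
    (φ : Ω → ℝ) : ℝ :=
  ⨅ τ : A, ∫ x, φ x ∂(Q τ)

/-- In a sequence of models with null hypotheses `P_n` and local alternatives `Q_{n,τ}`, where the
local parameter `τ` is in the scale in which the Fisher information is the identity, the sequence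
of tests `(φ_n)` is locally asymptotically maximin at asymptotic level `α`: it has asymptotic level
`α`, and, for each `c > 0`, no sequence of tests of asymptotic level `α` has an asymptotically
larger minimal power over the alternatives at distance at least `c`. The set of
alternatives at stake may be the full set `{‖τ‖ ≥ c}`, the sphere `{‖τ‖ = c}`, or any set `A` in
between, such as the shell `{c ≤ ‖τ‖ ≤ C}`. -/
def IsLocallyAsymptoticallyMaximin {Ω : ℕ → Type*} [∀ n, MeasurableSpace (Ω n)]
    {E : Type*} [NormedAddCommGroup E] (P : ∀ n, Measure (Ω n)) (Q : ∀ n, E → Measure (Ω n))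
    (α : ℝ) (φ : ∀ n, Ω n → ℝ) : Prop :=
  HasAsymptoticLevel P α φ ∧
  ∀ c : ℝ, 0 < c → ∀ A : Set E, {τ | ‖τ‖ = c} ⊆ A → A ⊆ {τ | c ≤ ‖τ‖} →
    ∀ ψ : ∀ n, Ω n → ℝ, HasAsymptoticLevel P α ψ →
      limsup (fun n => minPower (Q n) A (ψ n)) atTop
        ≤ liminf (fun n => minPower (Q n) A (φ n)) atTop

/-- The chi-square distribution with `p` degrees of freedom: the law of `‖Z‖²`, with `Z` standard
`p`-variate normal. -/
def chiSq (p : ℕ) : Measure ℝ := (stdGaussian (Vec p)).map (fun z => ‖z‖ ^ 2)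

/-- The quantile of order `u ∈ (0,1)` of the chi-square distribution with `p` degrees of freedom. -/
def chiSqQuantile (p : ℕ) (u : ℝ) : ℝ := sInf {q : ℝ | u ≤ cdf (chiSq p) q}

/-- The low-dimensional Rayleigh test: it rejects when `n p ‖X̄_n‖²` exceeds the `χ²_p`-quantile
of order `1 - α`. -/
def rayleighTest (p : ℕ) (α : ℝ) (n : ℕ) : Sample p n → ℝ :=
  Set.indicator {x | chiSqQuantile p (1 - α) < (n : ℝ) * p * ‖sampleMean p n x‖ ^ 2} (fun _ => 1)

theorem isProbabilityMeasure_uniformSphere {p : ℕ} (hp : 2 ≤ p) :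
    IsProbabilityMeasure (uniformSphere p) := by
  have : Nonempty (Fin p) := ⟨⟨0, by omega⟩⟩
  have h0 : surfaceMeasure p ≠ 0 := Measure.toSphere_ne_zero _
  have : IsFiniteMeasure (surfaceMeasure p) := by unfold surfaceMeasure; infer_instance
  refine ⟨?_⟩
  simp only [uniformSphere, Measure.smul_apply, smul_eq_mul]
  exact ENNReal.inv_mul_cancel (by simpa using h0) (measure_ne_top _ _)

theorem isProbabilityMeasure_nullLaw {p : ℕ} (hp : 2 ≤ p) (n : ℕ) :
    IsProbabilityMeasure (nullLaw p n) := by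
  have := isProbabilityMeasure_uniformSphere hp
  unfold nullLaw
  infer_instance

end SphereUniformity

end

noncomputable section

namespace SphereUniformity

/-! Write `μ = √(p/n) τ` and `u = x'μ`. Expanding `log f(u)` and the logarithm of the normalizing
mean to second order at `0`, the coefficient `f''(0)` survives only in front of the centred
variables `u² - ‖μ‖²/p`. Their sum over the sample has variance `O(1/n)`, so the log-likelihood
ratio is `τ'Δ - ‖τ‖²/2` plus a remainder that is small in `L²` and bounded, uniformly over `‖τ‖ ≤ M`
(`exists_likRem_bound`). This gives (i). Since the exponential moments of `Δ` are bounded in `n`, it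
also gives `L¹` closeness of the likelihood ratio to `exp(τ'Δ - ‖τ‖²/2)`
(`eventually_integral_abs_lik_sub_le`), so powers can be computed under the null, uniformly over all
tests, with no contiguity argument.

For (ii), rotation invariance turns the characteristic function of `Δ` into that of a normalized sum
of i.i.d. real variables of variance one.

For (iii), let `I` be the function `meanCosh`. Averaging the Gaussian-shift likelihood over the
sphere of radius `t` gives `exp(-t²/2) I(t‖Δ‖)`, with `I` increasing on `[0, ∞)`. A minimum is at
most an average, and by Neyman-Pearson the Rayleigh test maximizes this average at radius `c`; its
limit `β` bounds every competitor from above. Conversely the Rayleigh test is rotation invariant, so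
its own approximate power depends on `‖τ‖` only. It is at least `β` asymptotically for `c ≤ ‖τ‖ ≤
M`, because `r ↦ I(tr)/I(cr)` is increasing for `t ≥ c`, a monotone likelihood ratio property
(`meanCosh_mul_le`, `mixPower_mul_le`). For `‖τ‖ ≥ M`, where no expansion is available, Chebyshev's
inequality and a lower bound on the mean of `X'θ` uniform in the concentration give power near one
(`exists_integral_rayleighTest_ge`). -/

/-! ### Rotation invariance of the uniform distribution -/

/-- The action of a linear isometry on the sphere. -/
def sphRot {p : ℕ} (R : Vec p ≃ₗᵢ[ℝ] Vec p) : Sph p ≃ₜ Sph p where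
  toFun x := ⟨R x, by simp⟩
  invFun x := ⟨R.symm x, by simp⟩
  left_inv x := by simp
  right_inv x := by simp
  continuous_toFun := by fun_prop
  continuous_invFun := by fun_prop

@[simp]
theorem coe_sphRot {p : ℕ} (R : Vec p ≃ₗᵢ[ℝ] Vec p) (x : Sph p) :
    (sphRot R x : Vec p) = R x := rfl

-- The surface measure of `s` is, up to a constant, the volume of the cone `(0,1) • s`; rotation
-- commutes with forming cones and preserves Lebesgue measure.
open scoped Pointwise in
theorem measurePreserving_sphRot_surfaceMeasure {p : ℕ} (R : Vec p ≃ₗᵢ[ℝ] Vec p) :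
    MeasurePreserving (sphRot R) (surfaceMeasure p) (surfaceMeasure p) := by
  refine ⟨(sphRot R).continuous.measurable, ?_⟩
  ext s hs
  rw [Measure.map_apply (sphRot R).continuous.measurable hs, surfaceMeasure,
    Measure.toSphere_apply' _ hs,
    Measure.toSphere_apply' _ ((sphRot R).continuous.measurable hs)]
  congr 1
  have hR : MeasurePreserving R := R.measurePreserving
  have key : Set.Ioo (0 : ℝ) 1 • (Subtype.val '' (sphRot R ⁻¹' s) : Set (Vec p))
      = R.toHomeomorph.toMeasurableEquiv ⁻¹' (Set.Ioo (0 : ℝ) 1 • (Subtype.val '' s : Set (Vec p))) := by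
    ext y
    simp only [Set.mem_smul, Set.mem_image, Set.mem_preimage]
    constructor
    · rintro ⟨r, hr, _, ⟨x, hx, rfl⟩, rfl⟩
      exact ⟨r, hr, _, ⟨sphRot R x, hx, rfl⟩, by simp⟩
    · rintro ⟨r, hr, _, ⟨x, hx, rfl⟩, h⟩
      refine ⟨r, hr, _, ⟨(sphRot R).symm x, by simpa using hx, rfl⟩, ?_⟩
      apply R.injective
      have h2 : R ((sphRot R).symm x : Vec p) = x := by
        rw [← coe_sphRot, Homeomorph.apply_symm_apply]
      rw [map_smul, h2]
      exact h
  rw [key]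
  exact hR.measure_preimage_equiv (f := R.toHomeomorph.toMeasurableEquiv) _

theorem measurePreserving_sphRot {p : ℕ} (R : Vec p ≃ₗᵢ[ℝ] Vec p) :
    MeasurePreserving (sphRot R) (uniformSphere p) (uniformSphere p) :=
  (measurePreserving_sphRot_surfaceMeasure R).smul_measure _

/-- The reflection in the hyperplane orthogonal to `z - z'` does it. -/
theorem exists_isometry_of_norm_eq {p : ℕ} {z z' : Vec p} (h : ‖z‖ = ‖z'‖) :
    ∃ R : Vec p ≃ₗᵢ[ℝ] Vec p, R z = z' :=
  ⟨_, Submodule.reflection_sub h⟩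

theorem integral_inner_congr_norm {p : ℕ} {F : Type*} [NormedAddCommGroup F] [NormedSpace ℝ F]
    (G : ℝ → F) {z z' : Vec p} (h : ‖z‖ = ‖z'‖) :
    ∫ x : Sph p, G ⟪(x : Vec p), z⟫ ∂(uniformSphere p)
      = ∫ x : Sph p, G ⟪(x : Vec p), z'⟫ ∂(uniformSphere p) := by
  obtain ⟨R, hR⟩ := exists_isometry_of_norm_eq h.symm
  rw [← (measurePreserving_sphRot R).integral_comp (sphRot R).measurableEmbedding]
  simp [← hR, LinearIsometryEquiv.inner_map_map]

theorem measurable_inner_sph {p : ℕ} (z : Vec p) :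
    Measurable fun x : Sph p => ⟪(x : Vec p), z⟫ :=
  Continuous.measurable (by fun_prop)

theorem abs_inner_sph_le {p : ℕ} (x : Sph p) (z : Vec p) : |⟪(x : Vec p), z⟫| ≤ ‖z‖ := by
  simpa using abs_real_inner_le_norm (x : Vec p) z

theorem integrable_inner_of_bdd {p : ℕ} [IsProbabilityMeasure (uniformSphere p)] {G : ℝ → ℝ}
    (hG : Measurable G) (z : Vec p) {K : ℝ} (hK : ∀ u, |u| ≤ ‖z‖ → |G u| ≤ K) :
    Integrable (fun x : Sph p => G ⟪(x : Vec p), z⟫) (uniformSphere p) :=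
  Integrable.of_bound (hG.comp (measurable_inner_sph z)).aestronglyMeasurable K
    (ae_of_all _ fun x => hK _ (abs_inner_sph_le x z))

theorem integral_inner_neg {p : ℕ} (G : ℝ → ℝ) (z : Vec p) :
    ∫ x : Sph p, G (-⟪(x : Vec p), z⟫) ∂(uniformSphere p)
      = ∫ x : Sph p, G ⟪(x : Vec p), z⟫ ∂(uniformSphere p) := by
  rw [integral_inner_congr_norm G (z := z) (z' := -z) (by simp)]
  simp

theorem integral_inner_sph {p : ℕ} (z : Vec p) :
    ∫ x : Sph p, ⟪(x : Vec p), z⟫ ∂(uniformSphere p) = 0 := by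
  have h := integral_inner_neg id z
  simp only [id, integral_neg] at h
  linarith

/-- By invariance `z` may be replaced by `‖z‖` times any vector of an orthonormal basis; the `p`
equal integrals add up to `‖z‖²` because `x` is a unit vector. -/
theorem integral_inner_sq_sph {p : ℕ} (hp : 2 ≤ p) (z : Vec p) :
    ∫ x : Sph p, ⟪(x : Vec p), z⟫ ^ 2 ∂(uniformSphere p) = ‖z‖ ^ 2 / p := by
  have := isProbabilityMeasure_uniformSphere hp
  let b : OrthonormalBasis (Fin p) ℝ (Vec p) := EuclideanSpace.basisFun (Fin p) ℝ
  have h1 : ∀ i, ∫ x : Sph p, ⟪(x : Vec p), z⟫ ^ 2 ∂(uniformSphere p)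
      = ∫ x : Sph p, ⟪(x : Vec p), ‖z‖ • b i⟫ ^ 2 ∂(uniformSphere p) := fun i =>
    integral_inner_congr_norm (fun u => u ^ 2) (by simp [norm_smul])
  have h2 : ∑ i, ∫ x : Sph p, ⟪(x : Vec p), ‖z‖ • b i⟫ ^ 2 ∂(uniformSphere p) = ‖z‖ ^ 2 := by
    rw [← integral_finsetSum]
    · have : ∀ x : Sph p, ∑ i, ⟪(x : Vec p), ‖z‖ • b i⟫ ^ 2 = ‖z‖ ^ 2 := by
        intro x
        simp_rw [real_inner_smul_right, mul_pow, ← Finset.mul_sum, b.sum_sq_inner_left]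
        simp
      simp [this]
    · intro i _
      exact integrable_inner_of_bdd (G := fun u => u ^ 2) (by fun_prop) _
        (K := ‖‖z‖ • b i‖ ^ 2) fun u hu => by
          rw [abs_pow]; exact pow_le_pow_left₀ (abs_nonneg _) hu 2
  rw [← Finset.sum_congr rfl (fun i _ => h1 i)] at h2
  simp only [Finset.sum_const, Finset.card_univ, Fintype.card_fin, nsmul_eq_mul] at h2
  have : (p : ℝ) ≠ 0 := by positivity
  field_simp
  linarith

theorem exists_norm_eq {p : ℕ} (hp : 2 ≤ p) {c : ℝ} (hc : 0 ≤ c) : ∃ e : Vec p, ‖e‖ = c := by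
  refine ⟨c • EuclideanSpace.single (⟨0, by omega⟩ : Fin p) (1 : ℝ), ?_⟩
  simp [norm_smul, abs_of_nonneg hc]

/-- The action of a linear isometry on samples. -/
def sampleRot {p n : ℕ} (R : Vec p ≃ₗᵢ[ℝ] Vec p) : Sample p n ≃ₜ Sample p n :=
  Homeomorph.piCongrRight fun _ => sphRot R

theorem measurePreserving_sampleRot {p : ℕ} (hp : 2 ≤ p) (n : ℕ) (R : Vec p ≃ₗᵢ[ℝ] Vec p) :
    MeasurePreserving (sampleRot R) (nullLaw p n) (nullLaw p n) := by
  have := isProbabilityMeasure_uniformSphere hp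
  exact measurePreserving_pi _ _ fun _ => measurePreserving_sphRot R

theorem centralSeq_eq {p n : ℕ} (x : Sample p n) :
    centralSeq p n x = √((p : ℝ) / n) • ∑ i, (x i : Vec p) := by
  rw [centralSeq, sampleMean, smul_smul]
  congr 1
  rcases Nat.eq_zero_or_pos n with rfl | hn
  · simp
  · have : (0 : ℝ) < n := by positivity
    rw [Real.sqrt_mul this.le, Real.sqrt_div (by positivity)]
    field_simp
    rw [Real.sq_sqrt this.le, mul_comm]

@[simp]
theorem centralSeq_sampleRot {p n : ℕ} (R : Vec p ≃ₗᵢ[ℝ] Vec p) (x : Sample p n) :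
    centralSeq p n (sampleRot R x) = R (centralSeq p n x) := by
  simp [centralSeq_eq, sampleRot, map_sum]

theorem continuous_centralSeq (p n : ℕ) : Continuous (centralSeq p n) := by
  unfold centralSeq sampleMean
  fun_prop

theorem sum_inner_eq {p n : ℕ} (x : Sample p n) (τ : Vec p) :
    ∑ i, ⟪(x i : Vec p), √((p : ℝ) / n) • τ⟫ = ⟪τ, centralSeq p n x⟫ := by
  rw [centralSeq_eq, ← sum_inner, real_inner_smul_right, real_inner_smul_right, real_inner_comm]

theorem norm_centralSeq_sq {p n : ℕ} (x : Sample p n) :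
    ‖centralSeq p n x‖ ^ 2 = n * p * ‖sampleMean p n x‖ ^ 2 := by
  rw [centralSeq, norm_smul, mul_pow, Real.norm_eq_abs, sq_abs, Real.sq_sqrt (by positivity)]

theorem norm_local_sq {p n : ℕ} (τ : Vec p) :
    ‖√((p : ℝ) / n) • τ‖ ^ 2 = p / n * ‖τ‖ ^ 2 := by
  rw [norm_smul, mul_pow, Real.norm_eq_abs, sq_abs, Real.sq_sqrt (by positivity)]

/-! ### Likelihood ratios -/

/-- It suffices to check boxes, on which the restricted product density is a product of functions of
single coordinates, independent under the product measure. -/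
theorem pi_withDensity {ι X : Type*} [Fintype ι] [MeasurableSpace X] (ν : Measure X)
    [IsProbabilityMeasure ν] {g : X → ℝ≥0∞} (hg : Measurable g)
    [IsProbabilityMeasure (ν.withDensity g)] :
    Measure.pi (fun _ : ι => ν.withDensity g)
      = (Measure.pi fun _ : ι => ν).withDensity (fun x => ∏ i, g (x i)) := by
  refine Measure.pi_eq fun s hs => ?_
  have hm : MeasurableSet (Set.pi Set.univ s) := MeasurableSet.univ_pi hs
  rw [withDensity_apply _ hm, ← lintegral_indicator hm]
  have h1 : ∀ x : ι → X, (Set.pi Set.univ s).indicator (fun x => ∏ i, g (x i)) x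
      = ∏ i, (s i).indicator g (x i) := by
    intro x
    by_cases hx : x ∈ Set.pi Set.univ s
    · rw [Set.indicator_of_mem hx]
      exact Finset.prod_congr rfl fun i _ => (Set.indicator_of_mem (hx i trivial) _).symm
    · rw [Set.indicator_of_notMem hx]
      simp only [Set.mem_pi, Set.mem_univ, true_implies, not_forall] at hx
      obtain ⟨i, hi⟩ := hx
      exact (Finset.prod_eq_zero (Finset.mem_univ i) (Set.indicator_of_notMem hi _)).symm
  simp_rw [h1]
  have hind : iIndepFun (fun i (x : ι → X) => (s i).indicator g (x i)) (Measure.pi fun _ : ι => ν) :=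
    iIndepFun_pi (X := fun i => (s i).indicator g)
      fun i => (hg.indicator (hs i)).aemeasurable
  have := lintegral_prod_eq_prod_lintegral_of_indepFun Finset.univ _ hind
    (fun i => (hg.indicator (hs i)).comp (measurable_pi_apply i))
  rw [this]
  refine Finset.prod_congr rfl fun i _ => ?_
  rw [withDensity_apply _ (hs i), ← lintegral_indicator (hs i)]
  exact (measurePreserving_eval (fun _ : ι => ν) i).lintegral_comp (hg.indicator (hs i))

theorem IsAngularFunction.pos {f : ℝ → ℝ} (hf : IsAngularFunction f) (x : ℝ) : 0 < f x :=
  (hf.nonneg (x - 1)).trans_lt (hf.strictMono (by linarith))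

theorem IsAngularFunction.measurable {f : ℝ → ℝ} (hf : IsAngularFunction f) : Measurable f :=
  hf.strictMono.monotone.measurable

/-- The mean of `f (x'μ)` under the uniform distribution. -/
def meanAng (p : ℕ) (f : ℝ → ℝ) (μ : Vec p) : ℝ := ∫ x : Sph p, f ⟪(x : Vec p), μ⟫ ∂(uniformSphere p)

/-- The density of one observation, with respect to the uniform distribution. -/
def lik1 (p : ℕ) (f : ℝ → ℝ) (μ : Vec p) (x : Sph p) : ℝ := f ⟪(x : Vec p), μ⟫ / meanAng p f μ

/-- The likelihood ratio of the sample. -/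
def lik (p n : ℕ) (f : ℝ → ℝ) (μ : Vec p) (x : Sample p n) : ℝ := ∏ i, lik1 p f μ (x i)

variable {p : ℕ} {f : ℝ → ℝ}

theorem integrable_ang (hp : 2 ≤ p) (hf : IsAngularFunction f) (μ : Vec p) :
    Integrable (fun x : Sph p => f ⟪(x : Vec p), μ⟫) (uniformSphere p) := by
  have := isProbabilityMeasure_uniformSphere hp
  refine integrable_inner_of_bdd hf.measurable μ (K := f ‖μ‖) fun u hu => ?_
  rw [abs_of_pos (hf.pos u)]
  exact hf.strictMono.monotone ((le_abs_self u).trans hu)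

theorem meanAng_pos (hp : 2 ≤ p) (hf : IsAngularFunction f) (μ : Vec p) : 0 < meanAng p f μ := by
  have := isProbabilityMeasure_uniformSphere hp
  have h : ∫ _ : Sph p, f (-‖μ‖) ∂(uniformSphere p) ≤ meanAng p f μ :=
    integral_mono (integrable_const _) (integrable_ang hp hf μ) fun x =>
      hf.strictMono.monotone (neg_le_of_abs_le (abs_inner_sph_le x μ))
  rw [integral_const, probReal_univ, one_smul] at h
  exact (hf.pos _).trans_le h

theorem lik1_pos (hp : 2 ≤ p) (hf : IsAngularFunction f) (μ : Vec p) (x : Sph p) :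
    0 < lik1 p f μ x := div_pos (hf.pos _) (meanAng_pos hp hf μ)

theorem measurable_lik1 (hf : IsAngularFunction f) (μ : Vec p) : Measurable (lik1 p f μ) :=
  (hf.measurable.comp (measurable_inner_sph μ)).div_const _

theorem integrable_lik1 (hp : 2 ≤ p) (hf : IsAngularFunction f) (μ : Vec p) :
    Integrable (lik1 p f μ) (uniformSphere p) := (integrable_ang hp hf μ).div_const _

theorem integral_lik1 (hp : 2 ≤ p) (hf : IsAngularFunction f) (μ : Vec p) :
    ∫ x, lik1 p f μ x ∂(uniformSphere p) = 1 := by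
  unfold lik1
  rw [integral_div]
  exact div_self (meanAng_pos hp hf μ).ne'

theorem lik_pos {n : ℕ} (hp : 2 ≤ p) (hf : IsAngularFunction f) (μ : Vec p) (x : Sample p n) :
    0 < lik p n f μ x := Finset.prod_pos fun _ _ => lik1_pos hp hf μ _

theorem measurable_lik {n : ℕ} (hf : IsAngularFunction f) (μ : Vec p) :
    Measurable (lik p n f μ) :=
  Finset.measurable_prod _ fun i _ => (measurable_lik1 hf μ).comp (measurable_pi_apply i)

/-- The polar coordinates of `μ` enter only through `κ x'θ = x'μ`, which also holds at `μ = 0`; the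
total surface mass cancels against the normalizing constant. -/
theorem rotSym_eq (hp : 2 ≤ p) (hf : IsAngularFunction f) (μ : Vec p) :
    rotSym p (‖μ‖⁻¹ • μ) ‖μ‖ f
      = (uniformSphere p).withDensity fun x => ENNReal.ofReal (lik1 p f μ x) := by
  have hprob := isProbabilityMeasure_uniformSphere hp
  have : Nonempty (Fin p) := ⟨⟨0, by omega⟩⟩
  have h0 : surfaceMeasure p ≠ 0 := Measure.toSphere_ne_zero _
  have : IsFiniteMeasure (surfaceMeasure p) := by unfold surfaceMeasure; infer_instance
  set m := surfaceMeasure p Set.univ with hm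
  have hm0 : m ≠ 0 := by simpa [hm] using h0
  have hmt : m ≠ ∞ := measure_ne_top _ _
  have hs : surfaceMeasure p = m • uniformSphere p := by
    rw [uniformSphere, smul_smul, ← hm, ENNReal.mul_inv_cancel hm0 hmt, one_smul]
  have hin : ∀ x : Sph p, ‖μ‖ * ⟪(x : Vec p), ‖μ‖⁻¹ • μ⟫ = ⟪(x : Vec p), μ⟫ := by
    intro x
    rw [real_inner_smul_right, ← mul_assoc]
    rcases eq_or_ne μ 0 with rfl | h
    · simp
    · rw [mul_inv_cancel₀ (norm_ne_zero_iff.2 h), one_mul]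
  have hc : normConst p (‖μ‖⁻¹ • μ) ‖μ‖ f = (m.toReal * meanAng p f μ)⁻¹ := by
    simp_rw [normConst, hin]
    rw [hs, integral_smul_measure]
    rfl
  rw [rotSym, hc]
  simp_rw [hin]
  nth_rw 1 [hs]
  rw [withDensity_smul_measure, ← withDensity_smul]
  · congr 1
    ext x
    simp only [Pi.smul_apply, smul_eq_mul, lik1]
    have hmr : 0 < m.toReal := ENNReal.toReal_pos hm0 hmt
    have hC := meanAng_pos hp hf μ
    nth_rw 1 [← ENNReal.ofReal_toReal hmt]
    rw [← ENNReal.ofReal_mul hmr.le]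
    congr 1
    field_simp
  · exact (((hf.measurable.comp (measurable_inner_sph μ)).const_mul _)).ennreal_ofReal

theorem isProbabilityMeasure_withDensity_lik1 (hp : 2 ≤ p) (hf : IsAngularFunction f)
    (μ : Vec p) :
    IsProbabilityMeasure
      ((uniformSphere p).withDensity fun x => ENNReal.ofReal (lik1 p f μ x)) := by
  refine ⟨?_⟩
  rw [withDensity_apply _ MeasurableSet.univ, Measure.restrict_univ,
    ← ofReal_integral_eq_lintegral_ofReal (integrable_lik1 hp hf μ)
      (ae_of_all _ fun x => (lik1_pos hp hf μ x).le), integral_lik1 hp hf, ENNReal.ofReal_one]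

theorem isProbabilityMeasure_rotSym (hp : 2 ≤ p) (hf : IsAngularFunction f) (μ : Vec p) :
    IsProbabilityMeasure (rotSym p (‖μ‖⁻¹ • μ) ‖μ‖ f) := by
  rw [rotSym_eq hp hf]
  exact isProbabilityMeasure_withDensity_lik1 hp hf μ

theorem isProbabilityMeasure_muLaw (hp : 2 ≤ p) (hf : IsAngularFunction f) (n : ℕ) (μ : Vec p) :
    IsProbabilityMeasure (muLaw p n μ f) := by
  have := isProbabilityMeasure_rotSym hp hf μ
  unfold muLaw sampleLaw
  infer_instance

theorem muLaw_eq (hp : 2 ≤ p) (hf : IsAngularFunction f) (n : ℕ) (μ : Vec p) :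
    muLaw p n μ f = (nullLaw p n).withDensity fun x => ENNReal.ofReal (lik p n f μ x) := by
  have := isProbabilityMeasure_uniformSphere hp
  have := isProbabilityMeasure_withDensity_lik1 hp hf μ
  rw [muLaw, sampleLaw, rotSym_eq hp hf, pi_withDensity _ (measurable_lik1 hf μ).ennreal_ofReal,
    nullLaw]
  congr 1
  ext x
  rw [lik, ENNReal.ofReal_prod_of_nonneg fun i _ => (lik1_pos hp hf μ _).le]

theorem integral_muLaw (hp : 2 ≤ p) (hf : IsAngularFunction f) (n : ℕ) (μ : Vec p)
    (φ : Sample p n → ℝ) :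
    ∫ x, φ x ∂(muLaw p n μ f) = ∫ x, φ x * lik p n f μ x ∂(nullLaw p n) := by
  rw [muLaw_eq hp hf, integral_withDensity_eq_integral_toReal_smul
    (measurable_lik hf μ).ennreal_ofReal (ae_of_all _ fun x => ENNReal.ofReal_lt_top)]
  refine integral_congr_ae (ae_of_all _ fun x => ?_)
  simp only [smul_eq_mul, ENNReal.toReal_ofReal (lik_pos hp hf μ x).le, mul_comm]

theorem llr_muLaw (hp : 2 ≤ p) (hf : IsAngularFunction f) (n : ℕ) (μ : Vec p) :
    llr (muLaw p n μ f) (nullLaw p n) =ᵐ[nullLaw p n] fun x => Real.log (lik p n f μ x) := by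
  have := isProbabilityMeasure_nullLaw hp n
  rw [muLaw_eq hp hf]
  filter_upwards [Measure.rnDeriv_withDensity (nullLaw p n)
    (measurable_lik hf μ (n := n)).ennreal_ofReal] with x hx
  rw [llr, hx, ENNReal.toReal_ofReal (lik_pos hp hf μ x).le]

theorem integrable_lik (hp : 2 ≤ p) (hf : IsAngularFunction f) (n : ℕ) (μ : Vec p) :
    Integrable (lik p n f μ) (nullLaw p n) := by
  have := isProbabilityMeasure_uniformSphere hp
  exact Integrable.fintype_prod (fun _ => integrable_lik1 hp hf μ)

/-! ### Second-order expansion of the log-likelihood ratio -/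

theorem abs_integral_le_of_abs_le {Ω : Type*} [MeasurableSpace Ω] {P : Measure Ω}
    [IsProbabilityMeasure P] {g : Ω → ℝ} {K : ℝ} (h : ∀ x, |g x| ≤ K) : |∫ x, g x ∂P| ≤ K := by
  have := norm_integral_le_of_norm_le_const (μ := P) (f := g) (C := K) (ae_of_all _ h)
  rwa [probReal_univ, mul_one] at this

/-- Mean value inequality for the Taylor remainder on `[-|x|, |x|]`: differentiability of `h'` at
`0` alone bounds the derivative of the remainder by `η|x|` there, so `h''` need not exist elsewhere.
-/
theorem TwiceDifferentiableAt.taylor {h : ℝ → ℝ} (hh : TwiceDifferentiableAt h 0) {η : ℝ}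
    (hη : 0 < η) :
    ∃ δ > 0, ∀ x, |x| ≤ δ →
      |h x - h 0 - deriv h 0 * x - deriv (deriv h) 0 / 2 * x ^ 2| ≤ η * x ^ 2 := by
  set b := deriv (deriv h) 0 / 2 with hb
  obtain ⟨h1, h2⟩ := hh
  have h3 := h2.hasDerivAt.isLittleO
  have h4 := (h3.def hη).and h1
  obtain ⟨δ, hδ, hball⟩ := Metric.eventually_nhds_iff.1 h4
  refine ⟨δ / 2, by positivity, fun x hx => ?_⟩
  let g : ℝ → ℝ := fun x => h x - h 0 - deriv h 0 * x - b * x ^ 2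
  have hg : ∀ y ∈ Set.Icc (-|x|) |x|,
      HasDerivWithinAt g (deriv h y - deriv h 0 - (deriv (deriv h) 0) * y) (Set.Icc (-|x|) |x|) y := by
    intro y hy
    have hy' : dist y 0 < δ := by
      rw [Real.dist_eq, sub_zero]
      exact ((abs_le.2 ⟨hy.1, hy.2⟩).trans hx).trans_lt (by linarith)
    have hd := (hball hy').2.hasDerivAt
    have := ((hd.sub_const (h 0)).sub ((hasDerivAt_id y).const_mul (deriv h 0))).sub
      (((hasDerivAt_id y).pow 2).const_mul b)
    refine (this.congr_deriv ?_).hasDerivWithinAt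
    simp [hb]
    ring
  have hbd : ∀ y ∈ Set.Icc (-|x|) |x|,
      ‖deriv h y - deriv h 0 - (deriv (deriv h) 0) * y‖ ≤ η * |x| := by
    intro y hy
    have hyx : |y| ≤ |x| := abs_le.2 ⟨hy.1, hy.2⟩
    have hy' : dist y 0 < δ := by
      rw [Real.dist_eq, sub_zero]
      exact (hyx.trans hx).trans_lt (by linarith)
    have := (hball hy').1
    simp only [sub_zero, smul_eq_mul, Real.norm_eq_abs] at this ⊢
    rw [mul_comm y] at this
    exact this.trans (mul_le_mul_of_nonneg_left hyx hη.le)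
  have := (convex_Icc (-|x|) |x|).norm_image_sub_le_of_norm_hasDerivWithin_le hg hbd
    (x := 0) (y := x) ⟨by simp, by simp⟩ ⟨neg_abs_le x, le_abs_self x⟩
  simp only [g, Real.norm_eq_abs, sub_zero] at this
  have e : η * x ^ 2 = η * |x| * |x| := by rw [mul_assoc, abs_mul_abs_self]; ring
  rw [e]
  simpa using this

theorem IsAngularFunction.deriv_zero (hf : IsAngularFunction f) : deriv f 0 = 1 :=
  hf.hasDerivAt_zero.deriv

theorem IsAngularFunction.deriv_log_eventuallyEq (hf : IsAngularFunction f)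
    (hf2 : TwiceDifferentiableAt f 0) :
    deriv (fun x => Real.log (f x)) =ᶠ[𝓝 0] fun x => deriv f x / f x := by
  filter_upwards [hf2.1] with y hy
  exact (hy.hasDerivAt.log (hf.pos y).ne').deriv

theorem IsAngularFunction.hasDerivAt_deriv_div (hf : IsAngularFunction f)
    (hf2 : TwiceDifferentiableAt f 0) :
    HasDerivAt (fun x => deriv f x / f x) (deriv (deriv f) 0 - 1) 0 := by
  have := hf2.2.hasDerivAt.div hf.hasDerivAt_zero (hf.pos 0).ne'
  refine this.congr_deriv ?_
  simp [hf.map_zero, hf.deriv_zero]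

theorem IsAngularFunction.taylor_log (hf : IsAngularFunction f)
    (hf2 : TwiceDifferentiableAt f 0) {η : ℝ} (hη : 0 < η) :
    ∃ δ > 0, ∀ x, |x| ≤ δ →
      |Real.log (f x) - x - (deriv (deriv f) 0 / 2 - 1 / 2) * x ^ 2| ≤ η * x ^ 2 := by
  have hE := hf.deriv_log_eventuallyEq hf2
  have hD := (hf.hasDerivAt_deriv_div hf2).congr_of_eventuallyEq hE
  have h1 : TwiceDifferentiableAt (fun x => Real.log (f x)) 0 := by
    refine ⟨?_, hD.differentiableAt⟩
    filter_upwards [hf2.1] with y hy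
    exact hy.log (hf.pos y).ne'
  obtain ⟨δ, hδ, H⟩ := h1.taylor hη
  refine ⟨δ, hδ, fun x hx => ?_⟩
  have := H x hx
  rw [hD.deriv, hE.self_of_nhds] at this
  simp only [hf.map_zero, hf.deriv_zero, Real.log_one] at this
  convert this using 2
  ring

/-- Integrate the Taylor expansion of `f`: the linear term vanishes by symmetry and the quadratic
one has mean `‖μ‖²/p`. -/
theorem exists_abs_meanAng_sub_le (hp : 2 ≤ p) (hf : IsAngularFunction f)
    (hf2 : TwiceDifferentiableAt f 0) {η : ℝ} (hη : 0 < η) :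
    ∃ δ > 0, ∀ μ : Vec p, ‖μ‖ ≤ δ →
      |meanAng p f μ - 1 - deriv (deriv f) 0 / 2 * (‖μ‖ ^ 2 / p)| ≤ η * ‖μ‖ ^ 2 := by
  have := isProbabilityMeasure_uniformSphere hp
  obtain ⟨δ, hδ, H⟩ := hf2.taylor hη
  refine ⟨δ, hδ, fun μ hμ => ?_⟩
  set b := deriv (deriv f) 0 / 2
  have hi := integrable_ang hp hf μ
  have hi1 : Integrable (fun x : Sph p => ⟪(x : Vec p), μ⟫) (uniformSphere p) :=
    integrable_inner_of_bdd (G := id) measurable_id μ (K := ‖μ‖) fun u hu => hu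
  have hi2 : Integrable (fun x : Sph p => ⟪(x : Vec p), μ⟫ ^ 2) (uniformSphere p) :=
    integrable_inner_of_bdd (G := fun u => u ^ 2) (by fun_prop) μ (K := ‖μ‖ ^ 2) fun u hu => by
      rw [abs_pow]; exact pow_le_pow_left₀ (abs_nonneg _) hu 2
  have e : meanAng p f μ - 1 - b * (‖μ‖ ^ 2 / p)
      = ∫ x : Sph p, (f ⟪(x : Vec p), μ⟫ - 1 - ⟪(x : Vec p), μ⟫ - b * ⟪(x : Vec p), μ⟫ ^ 2)
        ∂(uniformSphere p) := by
    have j1 : Integrable (fun x : Sph p => f ⟪(x : Vec p), μ⟫ - 1) (uniformSphere p) :=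
      hi.sub (integrable_const _)
    have j2 : Integrable (fun x : Sph p => f ⟪(x : Vec p), μ⟫ - 1 - ⟪(x : Vec p), μ⟫)
      (uniformSphere p) := j1.sub hi1
    rw [integral_sub j2 (hi2.const_mul b), integral_sub j1 hi1, integral_sub hi (integrable_const _),
      integral_inner_sph, integral_const_mul, integral_inner_sq_sph hp]
    simp [meanAng]
  rw [e]
  refine abs_integral_le_of_abs_le fun x => ?_
  have hx := abs_inner_sph_le x μ
  have := H _ (hx.trans hμ)
  rw [hf.map_zero, hf.deriv_zero, one_mul] at this
  refine this.trans (mul_le_mul_of_nonneg_left ?_ hη.le)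
  rw [← sq_abs]
  exact pow_le_pow_left₀ (abs_nonneg _) hx 2

theorem exists_abs_log_meanAng_sub_le (hp : 2 ≤ p) (hf : IsAngularFunction f)
    (hf2 : TwiceDifferentiableAt f 0) {η : ℝ} (hη : 0 < η) :
    ∃ δ > 0, ∀ μ : Vec p, ‖μ‖ ≤ δ →
      |Real.log (meanAng p f μ) - deriv (deriv f) 0 / 2 * (‖μ‖ ^ 2 / p)| ≤ η * ‖μ‖ ^ 2 := by
  set b := deriv (deriv f) 0 / 2 with hb
  obtain ⟨δ₀, hδ₀, H₀⟩ := exists_abs_meanAng_sub_le hp hf hf2 (η := min (η / 2) 1) (by positivity)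
  set K := |b| + 1
  have hK : 0 < K := by positivity
  -- As `|C - 1| ≤ K‖μ‖²` for the mean `C`, the first bound keeps `C ≥ 1/2`, and the second makes
  -- the error `2(C - 1)²` of `log C ≈ C - 1` at most `η/2 ‖μ‖²`.
  refine ⟨min δ₀ (√(min (1 / (2 * K)) (η / (4 * K ^ 2)))), by positivity, fun μ hμ => ?_⟩
  have h0 := H₀ μ (hμ.trans (min_le_left _ _))
  have hs : ‖μ‖ ^ 2 ≤ min (1 / (2 * K)) (η / (4 * K ^ 2)) := by
    have := pow_le_pow_left₀ (norm_nonneg μ) (hμ.trans (min_le_right _ _)) 2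
    rwa [Real.sq_sqrt (by positivity)] at this
  have hs1 : K * ‖μ‖ ^ 2 ≤ 1 / 2 := by
    have := mul_le_mul_of_nonneg_left (hs.trans (min_le_left _ _)) hK.le
    refine this.trans (le_of_eq ?_)
    field_simp
  have hs2 : 2 * (K ^ 2 * ‖μ‖ ^ 2) ≤ η / 2 := by
    have := mul_le_mul_of_nonneg_left (hs.trans (min_le_right _ _)) (by positivity : 0 ≤ 2 * K ^ 2)
    rw [← mul_assoc]
    refine this.trans (le_of_eq ?_)
    field_simp
    norm_num
  set C := meanAng p f μ
  have hC := meanAng_pos hp hf μ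
  have hs0 : 0 ≤ ‖μ‖ ^ 2 := by positivity
  have hpp : ‖μ‖ ^ 2 / p ≤ ‖μ‖ ^ 2 := div_le_self hs0 (by exact_mod_cast (by omega : 1 ≤ p))
  have hC1 : |C - 1| ≤ K * ‖μ‖ ^ 2 := by
    have h5 : |b * (‖μ‖ ^ 2 / p)| ≤ |b| * ‖μ‖ ^ 2 := by
      rw [abs_mul, abs_of_nonneg (by positivity : 0 ≤ ‖μ‖ ^ 2 / p)]
      gcongr
    have h6 : |C - 1 - b * (‖μ‖ ^ 2 / p)| ≤ 1 * ‖μ‖ ^ 2 :=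
      h0.trans (mul_le_mul_of_nonneg_right (min_le_right _ _) hs0)
    calc |C - 1| = |(C - 1 - b * (‖μ‖ ^ 2 / p)) + b * (‖μ‖ ^ 2 / p)| := by ring_nf
      _ ≤ _ := abs_add_le _ _
      _ ≤ K * ‖μ‖ ^ 2 := by simp only [K]; linarith
  have hChalf : 1 / 2 ≤ C := by have := neg_le_of_abs_le (hC1.trans hs1); linarith
  have hlog : |Real.log C - (C - 1)| ≤ 2 * (C - 1) ^ 2 := by
    have u := Real.log_le_sub_one_of_pos hC
    have l := Real.one_sub_inv_le_log_of_pos hC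
    rw [abs_le]
    refine ⟨?_, by nlinarith [sq_nonneg (C - 1)]⟩
    have : C⁻¹ * (C - 1) ^ 2 ≤ 2 * (C - 1) ^ 2 :=
      mul_le_mul_of_nonneg_right (by rw [inv_le_comm₀ hC (by norm_num)]; linarith) (sq_nonneg _)
    have e : C⁻¹ * (C - 1) ^ 2 = C - 2 + C⁻¹ := by field_simp; ring
    change -(2 * (C - 1) ^ 2) ≤ _
    linarith
  have hsq : 2 * (C - 1) ^ 2 ≤ η / 2 * ‖μ‖ ^ 2 := by
    have : (C - 1) ^ 2 ≤ (K * ‖μ‖ ^ 2) ^ 2 := by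
      rw [← sq_abs]; exact pow_le_pow_left₀ (abs_nonneg _) hC1 2
    calc 2 * (C - 1) ^ 2 ≤ 2 * (K * ‖μ‖ ^ 2) ^ 2 := by linarith
      _ = 2 * (K ^ 2 * ‖μ‖ ^ 2) * ‖μ‖ ^ 2 := by ring
      _ ≤ _ := mul_le_mul_of_nonneg_right hs2 hs0
  calc |Real.log C - b * (‖μ‖ ^ 2 / p)|
      = |(Real.log C - (C - 1)) + (C - 1 - b * (‖μ‖ ^ 2 / p))| := by ring_nf
    _ ≤ _ := abs_add_le _ _
    _ ≤ η / 2 * ‖μ‖ ^ 2 + η / 2 * ‖μ‖ ^ 2 := add_le_add (hlog.trans hsq)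
        (h0.trans (mul_le_mul_of_nonneg_right (min_le_left _ _) hs0))
    _ = _ := by ring

/-- With `b = f''(0)/2`, `log f(u)` contributes `u + (b - 1/2)u²` and the normalization `-b‖μ‖²/p`.
Centring `u²` leaves `-‖μ‖²/(2p)`, free of `b`: this is why the limit experiment does not depend on
`f`. -/
theorem exists_abs_log_lik1_sub_le (hp : 2 ≤ p) (hf : IsAngularFunction f)
    (hf2 : TwiceDifferentiableAt f 0) {η : ℝ} (hη : 0 < η) :
    ∃ δ > 0, ∀ μ : Vec p, ‖μ‖ ≤ δ → ∀ x : Sph p,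
      |Real.log (lik1 p f μ x) - (⟪(x : Vec p), μ⟫ - 1 / 2 * (‖μ‖ ^ 2 / p)
        + (deriv (deriv f) 0 / 2 - 1 / 2) * (⟪(x : Vec p), μ⟫ ^ 2 - ‖μ‖ ^ 2 / p))|
        ≤ η * ‖μ‖ ^ 2 := by
  obtain ⟨δ₁, hδ₁, H₁⟩ := hf.taylor_log hf2 (half_pos hη)
  obtain ⟨δ₂, hδ₂, H₂⟩ := exists_abs_log_meanAng_sub_le hp hf hf2 (half_pos hη)
  refine ⟨min δ₁ δ₂, by positivity, fun μ hμ x => ?_⟩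
  have hx := abs_inner_sph_le x μ
  have h1 := H₁ _ (hx.trans (hμ.trans (min_le_left _ _)))
  have h2 := H₂ μ (hμ.trans (min_le_right _ _))
  have h3 : ⟪(x : Vec p), μ⟫ ^ 2 ≤ ‖μ‖ ^ 2 := by
    rw [← sq_abs]; exact pow_le_pow_left₀ (abs_nonneg _) hx 2
  rw [lik1, Real.log_div (hf.pos _).ne' (meanAng_pos hp hf μ).ne']
  set b := deriv (deriv f) 0 / 2
  set u := ⟪(x : Vec p), μ⟫
  have e : Real.log (f u) - Real.log (meanAng p f μ) - (u - 1 / 2 * (‖μ‖ ^ 2 / p)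
        + (b - 1 / 2) * (u ^ 2 - ‖μ‖ ^ 2 / p))
      = (Real.log (f u) - u - (b - 1 / 2) * u ^ 2)
        - (Real.log (meanAng p f μ) - b * (‖μ‖ ^ 2 / p)) := by ring
  rw [e]
  refine (abs_sub _ _).trans ?_
  nlinarith

/-- The remainder of the quadratic expansion of the log-likelihood ratio. -/
def likRem (p n : ℕ) (f : ℝ → ℝ) (τ : Vec p) (x : Sample p n) : ℝ :=
  Real.log (lik p n f (√((p : ℝ) / n) • τ) x)
    - (⟪τ, centralSeq p n x⟫ - 1 / 2 * ‖τ‖ ^ 2)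

theorem measurable_likRem {n : ℕ} (hf : IsAngularFunction f) (τ : Vec p) :
    Measurable (likRem p n f τ) := by
  have := (measurable_lik (n := n) hf (√((p : ℝ) / n) • τ)).log
  have h2 : Measurable fun x => ⟪τ, centralSeq p n x⟫ :=
    (continuous_const.inner (continuous_centralSeq p n)).measurable
  exact this.sub (h2.sub_const _)

/-- The summands are independent, centred and bounded by `‖μ‖²`, so the variances add. -/
theorem integral_sq_sum_inner_le (hp : 2 ≤ p) (n : ℕ) (μ : Vec p) :
    ∫ x, (∑ i, (⟪(x i : Vec p), μ⟫ ^ 2 - ‖μ‖ ^ 2 / p)) ^ 2 ∂(nullLaw p n) ≤ n * ‖μ‖ ^ 4 := by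
  have := isProbabilityMeasure_uniformSphere hp
  have := isProbabilityMeasure_nullLaw hp n
  let X : Sph p → ℝ := fun x => ⟪(x : Vec p), μ⟫ ^ 2 - ‖μ‖ ^ 2 / p
  have hX : Measurable X := ((measurable_inner_sph μ).pow_const 2).sub_const _
  have hs0 : 0 ≤ ‖μ‖ ^ 2 := by positivity
  have hpp : ‖μ‖ ^ 2 / p ≤ ‖μ‖ ^ 2 := div_le_self hs0 (by exact_mod_cast (by omega : 1 ≤ p))
  have hpp0 : 0 ≤ ‖μ‖ ^ 2 / p := by positivity
  have hXb : ∀ x, |X x| ≤ ‖μ‖ ^ 2 := by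
    intro x
    have h3 : ⟪(x : Vec p), μ⟫ ^ 2 ≤ ‖μ‖ ^ 2 := by
      rw [← sq_abs]; exact pow_le_pow_left₀ (abs_nonneg _) (abs_inner_sph_le x μ) 2
    have h4 := sq_nonneg ⟪(x : Vec p), μ⟫
    rw [abs_le]
    constructor <;> simp only [X] <;> linarith
  have hXm : MemLp X 2 (uniformSphere p) :=
    MemLp.of_bound hX.aestronglyMeasurable (‖μ‖ ^ 2) (ae_of_all _ hXb)
  have hX0 : ∫ x, X x ∂(uniformSphere p) = 0 := by
    have hi2 : Integrable (fun x : Sph p => ⟪(x : Vec p), μ⟫ ^ 2) (uniformSphere p) :=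
      integrable_inner_of_bdd (G := fun u => u ^ 2) (by fun_prop) μ (K := ‖μ‖ ^ 2) fun u hu => by
        rw [abs_pow]; exact pow_le_pow_left₀ (abs_nonneg _) hu 2
    simp only [X]
    rw [integral_sub hi2 (integrable_const _), integral_inner_sq_sph hp]
    simp
  have hV : Var[X; uniformSphere p] ≤ ‖μ‖ ^ 4 := by
    rw [variance_of_integral_eq_zero hX.aemeasurable hX0]
    refine (le_abs_self _).trans ?_
    refine abs_integral_le_of_abs_le fun x => ?_
    rw [abs_pow]
    calc |X x| ^ 2 ≤ (‖μ‖ ^ 2) ^ 2 := pow_le_pow_left₀ (abs_nonneg _) (hXb x) 2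
      _ = ‖μ‖ ^ 4 := by ring
  have hS := variance_sum_pi (μ := fun _ : Fin n => uniformSphere p) (X := fun _ => X)
    (fun _ => hXm)
  have hS0 : ∫ x : Sample p n, (∑ i, fun ω : Sample p n => X (ω i)) x ∂(nullLaw p n) = 0 := by
    simp only [Finset.sum_apply]
    rw [integral_finsetSum]
    · refine Finset.sum_eq_zero fun i _ => ?_
      rw [← hX0]
      exact integral_comp_eval (μ := fun _ : Fin n => uniformSphere p) (i := i)
        hX.aestronglyMeasurable
    · intro i _
      exact (measurePreserving_eval (fun _ : Fin n => uniformSphere p) i).integrable_comp_of_integrable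
        (hXm.integrable (by norm_num))
  have hSm : AEMeasurable (∑ i, fun ω : Sample p n => X (ω i)) (nullLaw p n) :=
    Finset.aemeasurable_sum _ fun i _ => (hX.comp (measurable_pi_apply i)).aemeasurable
  rw [← nullLaw, variance_of_integral_eq_zero hSm hS0] at hS
  simp only [Finset.sum_apply, X] at hS
  rw [hS]
  simp only [Finset.sum_const, Finset.card_univ, Fintype.card_fin, nsmul_eq_mul]
  exact mul_le_mul_of_nonneg_left hV (by positivity)

/-! ### Local asymptotic normality -/

/-- Summing the one-observation expansion: the linear terms give exactly `τ'Δ`, and `n‖μ‖² = p‖τ‖²`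
turns the constants into `‖τ‖²/2` and the error into `η p‖τ‖²`. -/
theorem exists_abs_likRem_sub_le (hp : 2 ≤ p) (hf : IsAngularFunction f)
    (hf2 : TwiceDifferentiableAt f 0) {η : ℝ} (hη : 0 < η) :
    ∃ δ > 0, ∀ n : ℕ, 0 < n → ∀ τ : Vec p, ‖√((p : ℝ) / n) • τ‖ ≤ δ → ∀ x : Sample p n,
      |likRem p n f τ x - (deriv (deriv f) 0 / 2 - 1 / 2) *
        ∑ i, (⟪(x i : Vec p), √((p : ℝ) / n) • τ⟫ ^ 2 - ‖√((p : ℝ) / n) • τ‖ ^ 2 / p)|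
        ≤ η * (p * ‖τ‖ ^ 2) := by
  obtain ⟨δ, hδ, H⟩ := exists_abs_log_lik1_sub_le hp hf hf2 hη
  refine ⟨δ, hδ, fun n hn τ hτ x => ?_⟩
  have hp0 : (0 : ℝ) < p := by positivity
  have hn0 : (0 : ℝ) < n := by positivity
  have hμ := norm_local_sq (p := p) (n := n) τ
  have hS := sum_inner_eq x τ
  set μ := √((p : ℝ) / n) • τ
  set a := deriv (deriv f) 0 / 2 - 1 / 2
  have e1 : Real.log (lik p n f μ x) = ∑ i, Real.log (lik1 p f μ (x i)) :=
    Real.log_prod fun i _ => (lik1_pos hp hf μ _).ne'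
  have e2 : likRem p n f τ x - a * ∑ i, (⟪(x i : Vec p), μ⟫ ^ 2 - ‖μ‖ ^ 2 / p)
      = ∑ i, (Real.log (lik1 p f μ (x i)) - (⟪(x i : Vec p), μ⟫ - 1 / 2 * (‖μ‖ ^ 2 / p)
        + a * (⟪(x i : Vec p), μ⟫ ^ 2 - ‖μ‖ ^ 2 / p))) := by
    symm
    rw [Finset.sum_sub_distrib, Finset.sum_add_distrib, ← Finset.mul_sum, Finset.sum_sub_distrib,
      hS, ← e1, Finset.sum_const, Finset.card_univ, Fintype.card_fin, nsmul_eq_mul, hμ, likRem]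
    have : (n : ℝ) * (1 / 2 * (p / n * ‖τ‖ ^ 2 / p)) = 1 / 2 * ‖τ‖ ^ 2 := by field_simp
    rw [this]
    ring
  rw [e2]
  refine (Finset.abs_sum_le_sum_abs _ _).trans ((Finset.sum_le_sum fun i _ => H μ hτ (x i)).trans ?_)
  rw [Finset.sum_const, Finset.card_univ, Fintype.card_fin, nsmul_eq_mul, hμ]
  apply le_of_eq
  field_simp

theorem abs_sq_inner_sub_le (hp : 2 ≤ p) (μ : Vec p) (x : Sph p) :
    |⟪(x : Vec p), μ⟫ ^ 2 - ‖μ‖ ^ 2 / p| ≤ ‖μ‖ ^ 2 := by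
  have h3 : ⟪(x : Vec p), μ⟫ ^ 2 ≤ ‖μ‖ ^ 2 := by
    rw [← sq_abs]; exact pow_le_pow_left₀ (abs_nonneg _) (abs_inner_sph_le x μ) 2
  have h4 := sq_nonneg ⟪(x : Vec p), μ⟫
  have hpp : ‖μ‖ ^ 2 / p ≤ ‖μ‖ ^ 2 :=
    div_le_self (by positivity) (by exact_mod_cast (by omega : 1 ≤ p))
  have hpp0 : 0 ≤ ‖μ‖ ^ 2 / p := by positivity
  rw [abs_le]
  constructor <;> linarith

/-- The second moment is what tends to zero. The deterministic bound `R`, chosen before `ε`, is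
needed later to control the exponential of the remainder. -/
theorem exists_likRem_bound (hp : 2 ≤ p) (hf : IsAngularFunction f)
    (hf2 : TwiceDifferentiableAt f 0) (M : ℝ) :
    ∃ R, ∀ ε > 0, ∀ᶠ n : ℕ in atTop, ∀ τ : Vec p, ‖τ‖ ≤ M →
      (∀ x, |likRem p n f τ x| ≤ R) ∧ ∫ x, likRem p n f τ x ^ 2 ∂(nullLaw p n) ≤ ε := by
  have hp0 : (0 : ℝ) < p := by positivity
  set a := deriv (deriv f) 0 / 2 - 1 / 2 with ha
  set D := p * M ^ 2 with hD
  have hD0 : 0 ≤ D := by positivity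
  refine ⟨|a| * D + D, fun ε hε => ?_⟩
  -- The cap at `1` keeps `R` independent of `ε`; the other term gives `2(ηD)² ≤ ε/2`.
  set η := min 1 (√ε / (2 * (D + 1)))
  have hη : 0 < η := by positivity
  obtain ⟨δ, hδ, H⟩ := exists_abs_likRem_sub_le hp hf hf2 hη
  have hlim1 : Tendsto (fun n : ℕ => √((p : ℝ) / n) * M) atTop (𝓝 0) := by
    have := ((tendsto_const_div_atTop_nhds_zero_nat (p : ℝ)).sqrt).mul_const M
    simpa using this
  have hlim2 : Tendsto (fun n : ℕ => 2 * a ^ 2 * D ^ 2 / (n : ℝ)) atTop (𝓝 0) :=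
    tendsto_const_div_atTop_nhds_zero_nat _
  filter_upwards [hlim1.eventually (gt_mem_nhds hδ),
    hlim2.eventually (gt_mem_nhds (half_pos hε)), eventually_gt_atTop 0] with n h1 h2 hn τ hτ
  have hn0 : (0 : ℝ) < n := by positivity
  have hM : 0 ≤ M := (norm_nonneg _).trans hτ
  have hτ2 : p * ‖τ‖ ^ 2 ≤ D := by simp only [hD]; gcongr
  have hτ2' : 0 ≤ p * ‖τ‖ ^ 2 := by positivity
  have hμδ : ‖√((p : ℝ) / n) • τ‖ ≤ δ := by
    rw [norm_smul, Real.norm_eq_abs, abs_of_nonneg (Real.sqrt_nonneg _)]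
    exact (mul_le_mul_of_nonneg_left hτ (Real.sqrt_nonneg _)).trans h1.le
  have hμ := norm_local_sq (p := p) (n := n) τ
  have H' := H n hn τ hμδ
  have hV := integral_sq_sum_inner_le hp n (√((p : ℝ) / n) • τ)
  set μ := √((p : ℝ) / n) • τ
  have hnμ : n * ‖μ‖ ^ 2 = p * ‖τ‖ ^ 2 := by rw [hμ]; field_simp
  set S : Sample p n → ℝ := fun x => ∑ i, (⟪(x i : Vec p), μ⟫ ^ 2 - ‖μ‖ ^ 2 / p)
  have hSb : ∀ x, |S x| ≤ D := by
    intro x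
    refine (Finset.abs_sum_le_sum_abs _ _).trans
      ((Finset.sum_le_sum fun i _ => abs_sq_inner_sub_le hp μ (x i)).trans ?_)
    rw [Finset.sum_const, Finset.card_univ, Fintype.card_fin, nsmul_eq_mul, hnμ]
    exact hτ2
  have := isProbabilityMeasure_nullLaw hp n
  have hrS : ∀ x, |likRem p n f τ x| ≤ |a| * |S x| + η * D := by
    intro x
    have h3 : |likRem p n f τ x - a * S x| ≤ η * (p * ‖τ‖ ^ 2) := H' x
    calc |likRem p n f τ x| = |(likRem p n f τ x - a * S x) + a * S x| := by ring_nf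
      _ ≤ |likRem p n f τ x - a * S x| + |a * S x| := abs_add_le _ _
      _ ≤ η * D + |a| * |S x| := by
        rw [abs_mul]
        have := mul_le_mul_of_nonneg_left hτ2 hη.le
        linarith
      _ = _ := by ring
  refine ⟨fun x => (hrS x).trans ?_, ?_⟩
  · have h5 := mul_le_mul_of_nonneg_left (hSb x) (abs_nonneg a)
    have h6 : η * D ≤ 1 * D := mul_le_mul_of_nonneg_right (min_le_left _ _) hD0
    linarith
  · have hSm : Measurable S := by
      refine Finset.measurable_fun_sum _ fun i _ => ?_
      exact (((measurable_inner_sph μ).pow_const 2).sub_const _).comp (measurable_pi_apply i)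
    have hS2 : Integrable (fun x => S x ^ 2) (nullLaw p n) :=
      Integrable.of_bound (hSm.pow_const 2).aestronglyMeasurable (D ^ 2)
        (ae_of_all _ fun x => by
          rw [norm_pow]; exact pow_le_pow_left₀ (norm_nonneg _) (hSb x) 2)
    have hηD : 2 * (η * D) ^ 2 ≤ ε / 2 := by
      have h7 : η * D ≤ √ε / 2 := by
        calc η * D ≤ √ε / (2 * (D + 1)) * D := mul_le_mul_of_nonneg_right (min_le_right _ _) hD0
          _ ≤ √ε / (2 * (D + 1)) * (D + 1) := by gcongr; linarith
          _ = √ε / 2 := by field_simp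
      have := pow_le_pow_left₀ (by positivity) h7 2
      rw [div_pow, Real.sq_sqrt hε.le] at this
      linarith
    have hpt : ∀ x, likRem p n f τ x ^ 2 ≤ 2 * a ^ 2 * S x ^ 2 + 2 * (η * D) ^ 2 := by
      intro x
      have h8 := pow_le_pow_left₀ (abs_nonneg _) (hrS x) 2
      rw [sq_abs] at h8
      rw [← sq_abs a, ← sq_abs (S x)]
      nlinarith [sq_nonneg (|a| * |S x| - η * D)]
    have hri : Integrable (fun x => 2 * a ^ 2 * S x ^ 2 + 2 * (η * D) ^ 2) (nullLaw p n) :=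
      (hS2.const_mul _).add (integrable_const _)
    calc ∫ x, likRem p n f τ x ^ 2 ∂(nullLaw p n)
        ≤ ∫ x, (2 * a ^ 2 * S x ^ 2 + 2 * (η * D) ^ 2) ∂(nullLaw p n) :=
          integral_mono_of_nonneg (ae_of_all _ fun x => sq_nonneg _) hri (ae_of_all _ hpt)
      _ = 2 * a ^ 2 * ∫ x, S x ^ 2 ∂(nullLaw p n) + 2 * (η * D) ^ 2 := by
          rw [integral_add (hS2.const_mul _) (integrable_const _), integral_const_mul]
          simp
      _ ≤ 2 * a ^ 2 * (n * ‖μ‖ ^ 4) + 2 * (η * D) ^ 2 := by gcongr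
      _ = 2 * a ^ 2 * (p * ‖τ‖ ^ 2) ^ 2 / n + 2 * (η * D) ^ 2 := by
          rw [← hnμ]; field_simp
      _ ≤ 2 * a ^ 2 * D ^ 2 / n + 2 * (η * D) ^ 2 := by gcongr
      _ ≤ ε := by linarith

/-- Markov's inequality for the squared remainder, once the Radon-Nikodym derivative is identified
almost everywhere with the explicit product. -/
theorem isLittleOP_llr (hp : 2 ≤ p) (hf : IsAngularFunction f) (hf2 : TwiceDifferentiableAt f 0)
    {τ : ℕ → Vec p} (hτ : τ =O[atTop] (fun _ => (1 : ℝ))) :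
    IsLittleOP (fun n => nullLaw p n)
      (fun n x => llr (muLaw p n (√((p : ℝ) / n) • τ n) f) (nullLaw p n) x
        - (⟪τ n, centralSeq p n x⟫ - 1 / 2 * ‖τ n‖ ^ 2)) := by
  obtain ⟨M, hM⟩ := hτ.bound
  obtain ⟨R, hR⟩ := exists_likRem_bound hp hf hf2 M
  intro ε hε
  rw [ENNReal.tendsto_nhds_zero]
  intro c hc
  obtain ⟨c', hc'0, hc'⟩ : ∃ c' : ℝ, 0 < c' ∧ ENNReal.ofReal c' ≤ c := by
    rcases eq_or_ne c ∞ with rfl | h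
    · exact ⟨1, one_pos, le_top⟩
    · exact ⟨c.toReal, ENNReal.toReal_pos hc.ne' h, by rw [ENNReal.ofReal_toReal h]⟩
  filter_upwards [hM, hR (ε ^ 2 * c') (by positivity)] with n h1 h2
  have := isProbabilityMeasure_nullLaw hp n
  obtain ⟨hb, hi⟩ := h2 (τ n) (by simpa using h1)
  have hae : nullLaw p n {x | ε ≤ |llr (muLaw p n (√((p : ℝ) / n) • τ n) f) (nullLaw p n) x
        - (⟪τ n, centralSeq p n x⟫ - 1 / 2 * ‖τ n‖ ^ 2)|}
      = nullLaw p n {x | ε ^ 2 ≤ likRem p n f (τ n) x ^ 2} := by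
    refine measure_congr ?_
    filter_upwards [llr_muLaw hp hf n (√((p : ℝ) / n) • τ n)] with x hx
    apply propext
    change ε ≤ |_ - _| ↔ ε ^ 2 ≤ likRem p n f (τ n) x ^ 2
    rw [hx, ← abs_of_pos hε, ← sq_le_sq, abs_of_pos hε, likRem]
  refine le_trans (le_of_eq hae) (le_trans ?_ hc')
  have hint : Integrable (fun x => likRem p n f (τ n) x ^ 2) (nullLaw p n) :=
    Integrable.of_bound ((measurable_likRem hf (τ n)).pow_const 2).aestronglyMeasurable (R ^ 2)
      (ae_of_all _ fun x => by
        rw [norm_pow]; exact pow_le_pow_left₀ (norm_nonneg _) (hb x) 2)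
  have hmk := mul_meas_ge_le_integral_of_nonneg (μ := nullLaw p n)
    (f := fun x => likRem p n f (τ n) x ^ 2) (ae_of_all _ fun x => sq_nonneg _) hint (ε ^ 2)
  have h9 : (nullLaw p n).real {x | ε ^ 2 ≤ likRem p n f (τ n) x ^ 2} ≤ c' := by
    have := hmk.trans hi
    exact le_of_mul_le_mul_left this (by positivity)
  rw [← ofReal_measureReal]
  exact ENNReal.ofReal_le_ofReal h9

/-! ### Approximation of the likelihood ratio in the mean -/

/-- The likelihood ratio of the limiting Gaussian shift, at the central sequence. -/
def gaussLik (p n : ℕ) (τ : Vec p) (x : Sample p n) : ℝ :=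
  Real.exp (⟪τ, centralSeq p n x⟫ - 1 / 2 * ‖τ‖ ^ 2)

theorem continuous_gaussLik (n : ℕ) (τ : Vec p) : Continuous (gaussLik p n τ) :=
  Real.continuous_exp.comp ((continuous_const.inner (continuous_centralSeq p n)).sub continuous_const)

theorem integrable_of_continuous (hp : 2 ≤ p) {n : ℕ} {g : Sample p n → ℝ} (hg : Continuous g) :
    Integrable g (nullLaw p n) := by
  have := isProbabilityMeasure_nullLaw hp n
  obtain ⟨K, hK⟩ := isCompact_univ.exists_bound_of_continuousOn hg.continuousOn
  exact Integrable.of_bound hg.aestronglyMeasurable K (ae_of_all _ fun x => hK x trivial)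

/-- Symmetry replaces `exp` by `cosh`, and `cosh u ≤ exp(u²/2)`. This sub-Gaussian bound tensorizes
to exponential moments of `Δ` bounded in `n`. -/
theorem integral_exp_inner_sph_le (hp : 2 ≤ p) (z : Vec p) :
    ∫ x : Sph p, Real.exp ⟪(x : Vec p), z⟫ ∂(uniformSphere p) ≤ Real.exp (‖z‖ ^ 2 / 2) := by
  have := isProbabilityMeasure_uniformSphere hp
  have hb : ∀ u : ℝ, |u| ≤ ‖z‖ → |Real.exp u| ≤ Real.exp ‖z‖ := fun u hu => by
    rw [Real.abs_exp]; exact Real.exp_le_exp.2 ((le_abs_self u).trans hu)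
  have hi := integrable_inner_of_bdd Real.measurable_exp z hb
  have hi' : Integrable (fun x : Sph p => Real.exp (-⟪(x : Vec p), z⟫)) (uniformSphere p) :=
    integrable_inner_of_bdd (G := fun u => Real.exp (-u)) (by fun_prop) z
      fun u hu => hb (-u) (by rwa [abs_neg])
  have h1 : ∫ x : Sph p, Real.exp ⟪(x : Vec p), z⟫ ∂(uniformSphere p)
      = ∫ x : Sph p, Real.cosh ⟪(x : Vec p), z⟫ ∂(uniformSphere p) := by
    simp_rw [Real.cosh_eq]
    rw [integral_div, integral_add hi hi', integral_inner_neg Real.exp z]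
    ring
  rw [h1]
  refine (le_abs_self _).trans (abs_integral_le_of_abs_le fun x => ?_)
  rw [abs_of_pos (Real.cosh_pos _)]
  refine (Real.cosh_le_exp_half_sq _).trans (Real.exp_le_exp.2 ?_)
  have h3 : ⟪(x : Vec p), z⟫ ^ 2 ≤ ‖z‖ ^ 2 := by
    rw [← sq_abs]; exact pow_le_pow_left₀ (abs_nonneg _) (abs_inner_sph_le x z) 2
  linarith

theorem integral_exp_centralSeq_le (hp : 2 ≤ p) {n : ℕ} (hn : 0 < n) (τ : Vec p) :
    ∫ x, Real.exp ⟪τ, centralSeq p n x⟫ ∂(nullLaw p n) ≤ Real.exp (p * ‖τ‖ ^ 2 / 2) := by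
  have := isProbabilityMeasure_uniformSphere hp
  have hn0 : (0 : ℝ) < n := by positivity
  simp_rw [← sum_inner_eq, Real.exp_sum]
  rw [nullLaw, integral_fintype_prod_eq_prod
    (f := fun _ (y : Sph p) => Real.exp ⟪(y : Vec p), √((p : ℝ) / n) • τ⟫)]
  rw [Finset.prod_const, Finset.card_univ, Fintype.card_fin]
  refine (pow_le_pow_left₀ (integral_nonneg fun _ => (Real.exp_pos _).le)
    (integral_exp_inner_sph_le hp _) n).trans (le_of_eq ?_)
  rw [← Real.exp_nat_mul, norm_local_sq]
  congr 1
  field_simp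

/-- With `G` the Gaussian likelihood and `r` the remainder, the difference is `G|exp r - 1| ≤ exp(R)
G|r|`. A weighted AM-GM separates `G²`, bounded in mean, from `r²`, small in mean. -/
theorem eventually_integral_abs_lik_sub_le (hp : 2 ≤ p) (hf : IsAngularFunction f)
    (hf2 : TwiceDifferentiableAt f 0) (M : ℝ) {ε : ℝ} (hε : 0 < ε) :
    ∀ᶠ n : ℕ in atTop, ∀ τ : Vec p, ‖τ‖ ≤ M →
      ∫ x, |lik p n f (√((p : ℝ) / n) • τ) x - gaussLik p n τ x| ∂(nullLaw p n) ≤ ε := by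
  obtain ⟨R, hR⟩ := exists_likRem_bound hp hf hf2 M
  -- `K` bounds the mean of `G² ≤ exp((2τ)'Δ)`, since `p‖2τ‖²/2 = 2p‖τ‖²`. The weight `η` and the
  -- tolerance on the mean of `r²` are set so that each half contributes `ε/2`.
  set K := Real.exp (2 * p * M ^ 2)
  set η := ε / (Real.exp R * K)
  have hη : 0 < η := by positivity
  have hε' : 0 < η * ε / Real.exp R := by positivity
  filter_upwards [hR _ hε', eventually_gt_atTop 0] with n h1 hn τ hτ
  have := isProbabilityMeasure_nullLaw hp n
  obtain ⟨hb, hi⟩ := h1 τ hτ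
  have hG2 : ∫ x, gaussLik p n τ x ^ 2 ∂(nullLaw p n) ≤ K := by
    have hle : ∀ x, gaussLik p n τ x ^ 2 ≤ Real.exp ⟪(2 : ℝ) • τ, centralSeq p n x⟫ := by
      intro x
      rw [gaussLik, ← Real.exp_nat_mul, real_inner_smul_left]
      refine Real.exp_le_exp.2 ?_
      push_cast
      nlinarith [sq_nonneg ‖τ‖]
    have hc : Continuous fun x => Real.exp ⟪(2 : ℝ) • τ, centralSeq p n x⟫ :=
      Real.continuous_exp.comp (continuous_const.inner (continuous_centralSeq p n))
    refine (integral_mono (integrable_of_continuous hp ((continuous_gaussLik n τ).pow 2))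
      (integrable_of_continuous hp hc) hle).trans
      ((integral_exp_centralSeq_le hp hn _).trans (Real.exp_le_exp.2 ?_))
    rw [norm_smul, mul_pow]
    have : ‖τ‖ ^ 2 ≤ M ^ 2 := pow_le_pow_left₀ (norm_nonneg _) hτ 2
    norm_num
    nlinarith [(by positivity : (0 : ℝ) < p)]
  have hpt : ∀ x, |lik p n f (√((p : ℝ) / n) • τ) x - gaussLik p n τ x|
      ≤ Real.exp R * ((η * gaussLik p n τ x ^ 2 + likRem p n f τ x ^ 2 / η) / 2) := by
    intro x
    have hL : lik p n f (√((p : ℝ) / n) • τ) x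
        = gaussLik p n τ x * Real.exp (likRem p n f τ x) := by
      rw [gaussLik, ← Real.exp_add, likRem, add_sub_cancel, Real.exp_log (lik_pos hp hf _ _)]
    set G := gaussLik p n τ x
    set r := likRem p n f τ x
    have hG : 0 < G := Real.exp_pos _
    have hr : |Real.exp r - 1| ≤ |r| * Real.exp R := by
      have e1 := Real.add_one_le_exp r
      have e2 := Real.add_one_le_exp (-r)
      have e3 : Real.exp r ≤ Real.exp R := Real.exp_le_exp.2 ((le_abs_self _).trans (hb x))
      have e4 : 1 ≤ Real.exp R := Real.one_le_exp ((abs_nonneg _).trans (hb x))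
      have e5 : Real.exp r - 1 ≤ r * Real.exp r := by
        have := mul_le_mul_of_nonneg_left e2 (Real.exp_pos r).le
        rw [← Real.exp_add, add_neg_cancel, Real.exp_zero] at this
        linarith
      rw [abs_le]
      constructor
      · nlinarith [neg_abs_le r, abs_nonneg r]
      · refine e5.trans ?_
        exact mul_le_mul (le_abs_self r) e3 (Real.exp_pos _).le (abs_nonneg _)
    have hL' : lik p n f (√((p : ℝ) / n) • τ) x - G = G * (Real.exp r - 1) := by rw [hL]; ring
    rw [hL', abs_mul, abs_of_pos hG]
    have hamgm : G * |r| ≤ (η * G ^ 2 + r ^ 2 / η) / 2 := by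
      have h5 : r ^ 2 / η = η * (|r| / η) ^ 2 := by rw [← sq_abs r]; field_simp
      have h6 : G * |r| = η * (G * (|r| / η)) := by field_simp
      rw [h5, h6]
      nlinarith [sq_nonneg (G - |r| / η)]
    calc G * |Real.exp r - 1| ≤ G * (|r| * Real.exp R) := by gcongr
      _ = Real.exp R * (G * |r|) := by ring
      _ ≤ _ := by gcongr
  have hint : Integrable (fun x => likRem p n f τ x ^ 2) (nullLaw p n) :=
    Integrable.of_bound ((measurable_likRem hf τ).pow_const 2).aestronglyMeasurable (R ^ 2)
      (ae_of_all _ fun x => by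
        rw [norm_pow]; exact pow_le_pow_left₀ (norm_nonneg _) (hb x) 2)
  have hGi : Integrable (fun x => gaussLik p n τ x ^ 2) (nullLaw p n) :=
    integrable_of_continuous hp ((continuous_gaussLik n τ).pow 2)
  have hri : Integrable (fun x => Real.exp R *
      ((η * gaussLik p n τ x ^ 2 + likRem p n f τ x ^ 2 / η) / 2)) (nullLaw p n) :=
    (((hGi.const_mul η).add (hint.div_const η)).div_const 2).const_mul _
  calc _ ≤ ∫ x, Real.exp R *
      ((η * gaussLik p n τ x ^ 2 + likRem p n f τ x ^ 2 / η) / 2) ∂(nullLaw p n) :=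
        integral_mono_of_nonneg (ae_of_all _ fun x => abs_nonneg _) hri (ae_of_all _ hpt)
    _ = Real.exp R * ((η * ∫ x, gaussLik p n τ x ^ 2 ∂(nullLaw p n)
        + (∫ x, likRem p n f τ x ^ 2 ∂(nullLaw p n)) / η) / 2) := by
      rw [integral_const_mul, integral_div, integral_add (hGi.const_mul η) (hint.div_const η),
        integral_const_mul, integral_div]
    _ ≤ Real.exp R * ((η * K + (η * ε / Real.exp R) / η) / 2) := by gcongr
    _ = ε := by
      have hK : K ≠ 0 := (Real.exp_pos _).ne'
      simp only [η]
      field_simp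
      ring

/-! ### The central limit theorem for the central sequence -/

/-- By invariance `√(p/n) t` can be exchanged for `(‖t‖/√n) e`, which has the same norm; the choice
`‖e‖ = √p` gives `x'e` variance one, so the one-dimensional central limit theorem applies at `‖t‖`.
-/
theorem charFun_map_centralSeq (hp : 2 ≤ p) (n : ℕ) {e : Vec p} (he : ‖e‖ = √p) (t : Vec p) :
    charFun ((nullLaw p n).map (centralSeq p n)) t
      = charFun ((uniformSphere p).map fun x : Sph p => ⟪(x : Vec p), e⟫) ((√n)⁻¹ * ‖t‖) ^ n := by
  have := isProbabilityMeasure_uniformSphere hp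
  rw [charFun_apply, integral_map (continuous_centralSeq p n).aemeasurable
    (by fun_prop), charFun_apply_real, integral_map (measurable_inner_sph e).aemeasurable
    (by fun_prop)]
  have h1 : ∀ x : Sample p n, Complex.exp (⟪centralSeq p n x, t⟫ * Complex.I)
      = ∏ i, Complex.exp (⟪(x i : Vec p), √((p : ℝ) / n) • t⟫ * Complex.I) := by
    intro x
    rw [real_inner_comm, ← sum_inner_eq, ← Complex.exp_sum, ← Finset.sum_mul]
    push_cast
    rfl
  simp_rw [h1]
  rw [nullLaw, integral_fintype_prod_eq_prod
    (f := fun _ (y : Sph p) => Complex.exp (⟪(y : Vec p), √((p : ℝ) / n) • t⟫ * Complex.I)),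
    Finset.prod_const, Finset.card_univ, Fintype.card_fin]
  congr 1
  rw [integral_inner_congr_norm (fun u : ℝ => Complex.exp (u * Complex.I))
    (z' := ((√n)⁻¹ * ‖t‖) • e)]
  · refine integral_congr_ae (ae_of_all _ fun x => ?_)
    simp only [real_inner_smul_right]
    push_cast
    rfl
  · rw [norm_smul, norm_smul, he, Real.norm_eq_abs, Real.norm_eq_abs, abs_of_nonneg (by positivity),
      abs_of_nonneg (by positivity), Real.sqrt_div (by positivity)]
    ring

theorem tendstoInDistribution_centralSeq (hp : 2 ≤ p) :
    haveI := isProbabilityMeasure_nullLaw hp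
    TendstoInDistribution (fun n => centralSeq p n) atTop (id : Vec p → Vec p)
      (fun n => nullLaw p n) (stdGaussian (Vec p)) := by
  have := isProbabilityMeasure_nullLaw hp
  have := isProbabilityMeasure_uniformSphere hp
  refine ⟨fun n => (continuous_centralSeq p n).aemeasurable, aemeasurable_id, ?_⟩
  refine ProbabilityMeasure.tendsto_iff_tendsto_charFun.2 fun t => ?_
  obtain ⟨e, he⟩ := exists_norm_eq hp (Real.sqrt_nonneg p)
  simp only [ProbabilityMeasure.coe_mk, Measure.map_id]
  simp_rw [charFun_map_centralSeq hp _ he, charFun_stdGaussian]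
  have h := tendsto_charFun_inv_sqrt_mul_pow (P := uniformSphere p)
    (measurable_inner_sph e).aemeasurable (integral_inner_sph e) ?_ ‖t‖
  · simpa using h
  · have := integral_inner_sq_sph hp e
    rw [he, Real.sq_sqrt (by positivity), div_self (by positivity)] at this
    exact this

theorem tendsto_integral_centralSeq (hp : 2 ≤ p) {g : Vec p → ℝ} (hg : Continuous g) {K : ℝ}
    (hK : ∀ z, |g z| ≤ K) :
    Tendsto (fun n => ∫ x, g (centralSeq p n x) ∂(nullLaw p n)) atTop
      (𝓝 (∫ z, g z ∂(stdGaussian (Vec p)))) := by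
  have := isProbabilityMeasure_nullLaw hp
  have h := ProbabilityMeasure.tendsto_iff_forall_integral_tendsto.1
    (tendstoInDistribution_centralSeq hp).tendsto
  have h' := h (BoundedContinuousFunction.ofNormedAddCommGroup g hg K hK)
  simp only [ProbabilityMeasure.coe_mk, Measure.map_id,
    BoundedContinuousFunction.coe_ofNormedAddCommGroup] at h'
  refine h'.congr fun n => ?_
  exact integral_map (continuous_centralSeq p n).aemeasurable hg.aestronglyMeasurable

/-! ### Quantiles of the chi-square distribution -/

/-- Fubini: with the other coordinates fixed, the first one is confined to two values, and a
nondegenerate Gaussian has no atoms. -/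
theorem stdGaussian_norm_sq_eq (hp : 2 ≤ p) (q : ℝ) :
    stdGaussian (Vec p) {z | ‖z‖ ^ 2 = q} = 0 := by
  obtain ⟨k, rfl⟩ : ∃ k, p = k + 1 := ⟨p - 1, by omega⟩
  have hm : MeasurableSet {z : Vec (k + 1) | ‖z‖ ^ 2 = q} :=
    (isClosed_eq (by fun_prop) continuous_const).measurableSet
  rw [← map_pi_eq_stdGaussian, Measure.map_apply (by fun_prop) hm]
  have hP := measurePreserving_piFinSuccAbove (fun _ : Fin (k + 1) => gaussianReal 0 1) 0
  have hS : MeasurableSet {y : ℝ × (Fin k → ℝ) | y.1 ^ 2 + ∑ i, y.2 i ^ 2 = q} :=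
    (isClosed_eq (by fun_prop) continuous_const).measurableSet
  have he : WithLp.toLp 2 ⁻¹' {z : Vec (k + 1) | ‖z‖ ^ 2 = q}
      = MeasurableEquiv.piFinSuccAbove (fun _ : Fin (k + 1) => ℝ) 0 ⁻¹'
        {y : ℝ × (Fin k → ℝ) | y.1 ^ 2 + ∑ i, y.2 i ^ 2 = q} := by
    ext x
    simp [EuclideanSpace.real_norm_sq_eq, Fin.sum_univ_succ, Fin.tail]
  have := nullSingletonClass_gaussianReal (μ := 0) (v := 1) one_ne_zero
  rw [he, hP.measure_preimage hS.nullMeasurableSet]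
  rw [Measure.prod_apply_symm hS]
  refine (lintegral_congr fun y => ?_).trans lintegral_zero
  refine measure_mono_null (t := {√(q - ∑ i, y i ^ 2), -√(q - ∑ i, y i ^ 2)}) ?_
    ((Set.toFinite _).measure_zero _)
  intro a ha
  have ha' : a ^ 2 + ∑ i, y i ^ 2 = q := ha
  rw [← ha', add_sub_cancel_right, Real.sqrt_sq_eq_abs]
  rcases abs_choice a with h | h <;> simp [h]

instance isProbabilityMeasure_chiSq : IsProbabilityMeasure (chiSq p) :=
  Measure.isProbabilityMeasure_map (by fun_prop)

theorem chiSq_singleton (hp : 2 ≤ p) (q : ℝ) : chiSq p {q} = 0 := by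
  rw [chiSq, Measure.map_apply (by fun_prop) (measurableSet_singleton q)]
  exact stdGaussian_norm_sq_eq hp q

theorem continuous_cdf_chiSq (hp : 2 ≤ p) : Continuous (cdf (chiSq p)) := by
  refine continuous_iff_continuousAt.2 fun q => ?_
  rw [(monotone_cdf _).continuousAt_iff_leftLim_eq_rightLim, StieltjesFunction.rightLim_eq]
  have h := (cdf (chiSq p)).measure_singleton q
  rw [measure_cdf, chiSq_singleton hp, eq_comm, ENNReal.ofReal_eq_zero] at h
  exact le_antisymm ((monotone_cdf _).leftLim_le le_rfl) (by linarith)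

theorem cdf_chiSqQuantile (hp : 2 ≤ p) {u : ℝ} (h0 : 0 < u) (h1 : u < 1) :
    cdf (chiSq p) (chiSqQuantile p u) = u := by
  have hc := continuous_cdf_chiSq hp
  set F := cdf (chiSq p)
  have hne : {q : ℝ | u ≤ F q}.Nonempty :=
    ((tendsto_cdf_atTop (chiSq p)).eventually (lt_mem_nhds h1)).exists.imp fun _ h => le_of_lt h
  obtain ⟨m, hm⟩ := ((tendsto_cdf_atBot (chiSq p)).eventually (gt_mem_nhds h0)).exists
  have hbd : BddBelow {q : ℝ | u ≤ F q} := by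
    refine ⟨m, fun q hq => ?_⟩
    by_contra! h
    exact absurd (hq.trans ((monotone_cdf _) h.le)) (not_le.2 hm)
  have hmem : chiSqQuantile p u ∈ {q : ℝ | u ≤ F q} :=
    (isClosed_le continuous_const hc).csInf_mem hne hbd
  refine le_antisymm ?_ hmem
  have hle : ∀ᶠ q in 𝓝[<] (chiSqQuantile p u), F q ≤ u := by
    filter_upwards [self_mem_nhdsWithin] with q hq
    by_contra! h
    exact absurd (csInf_le hbd h.le) (not_le.2 hq)
  exact le_of_tendsto (hc.continuousAt.tendsto.mono_left nhdsWithin_le_nhds) hle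

theorem chiSqQuantile_nonneg (hp : 2 ≤ p) {u : ℝ} (h0 : 0 < u) (h1 : u < 1) :
    0 ≤ chiSqQuantile p u := by
  by_contra! h
  have h2 := cdf_chiSqQuantile hp h0 h1
  rw [cdf_eq_real, chiSq, map_measureReal_apply (by fun_prop) measurableSet_Iic] at h2
  have : (fun z : Vec p => ‖z‖ ^ 2) ⁻¹' Set.Iic (chiSqQuantile p u) = ∅ := by
    ext z
    simp only [Set.mem_preimage, Set.mem_Iic, Set.mem_empty_iff_false, iff_false, not_le]
    exact h.trans_le (by positivity)
  rw [this, measureReal_empty] at h2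
  exact h0.ne h2

/-! ### The Rayleigh test under the null hypothesis -/

theorem rayleighTest_eq (α : ℝ) (n : ℕ) (x : Sample p n) :
    rayleighTest p α n x
      = {z : Vec p | chiSqQuantile p (1 - α) < ‖z‖ ^ 2}.indicator (fun _ => 1)
        (centralSeq p n x) := by
  simp [rayleighTest, Set.indicator_apply, norm_centralSeq_sq]

theorem isTest_rayleighTest (α : ℝ) (n : ℕ) : IsTest (rayleighTest p α n) := by
  refine ⟨?_, fun x => Set.indicator_nonneg (by simp) x, fun x =>
    Set.indicator_le_self' (f := fun _ => (1 : ℝ)) (by simp) x⟩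
  refine measurable_const.indicator ?_
  simp_rw [← norm_centralSeq_sq]
  exact (isOpen_lt continuous_const ((continuous_centralSeq p n).norm.pow 2)).measurableSet

/-- Portmanteau: the boundary of the rejection region lies in a level set of the norm, which is null
for the Gaussian limit. -/
theorem tendsto_integral_rayleighTest (hp : 2 ≤ p) {α : ℝ} (h0 : 0 < α) (h1 : α < 1) :
    Tendsto (fun n => ∫ x, rayleighTest p α n x ∂(nullLaw p n)) atTop (𝓝 α) := by
  have := isProbabilityMeasure_nullLaw hp
  set q := chiSqQuantile p (1 - α) with hq
  have ho : IsOpen {z : Vec p | q < ‖z‖ ^ 2} := isOpen_lt continuous_const (by fun_prop)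
  have hfr : stdGaussian (Vec p) (frontier {z : Vec p | q < ‖z‖ ^ 2}) = 0 := by
    refine measure_mono_null ?_ (stdGaussian_norm_sq_eq hp q)
    refine (frontier_lt_subset_eq continuous_const (by fun_prop)).trans fun z hz => ?_
    exact Eq.symm hz
  have h := ProbabilityMeasure.tendsto_measure_of_null_frontier_of_tendsto'
    (tendstoInDistribution_centralSeq hp).tendsto (E := {z : Vec p | q < ‖z‖ ^ 2})
    (by simpa using hfr)
  simp only [ProbabilityMeasure.coe_mk, Measure.map_id] at h
  have hlim : (stdGaussian (Vec p)).real {z : Vec p | q < ‖z‖ ^ 2} = α := by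
    have h2 := cdf_chiSqQuantile hp (u := 1 - α) (by linarith) (by linarith)
    rw [cdf_eq_real, chiSq, map_measureReal_apply (by fun_prop) measurableSet_Iic, ← hq] at h2
    have h3 := probReal_compl_eq_one_sub (μ := stdGaussian (Vec p)) ho.measurableSet
    have h4 : {z : Vec p | q < ‖z‖ ^ 2}ᶜ = (fun z : Vec p => ‖z‖ ^ 2) ⁻¹' Set.Iic q := by
      ext z; simp
    rw [h4, h2] at h3
    linarith
  have h5 := (ENNReal.tendsto_toReal (measure_ne_top _ _)).comp h
  change Tendsto _ _ (𝓝 ((stdGaussian (Vec p)).real _)) at h5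
  rw [hlim] at h5
  refine h5.congr fun n => ?_
  simp only [Function.comp]
  rw [Measure.map_apply (continuous_centralSeq p n).measurable ho.measurableSet]
  have : rayleighTest p α n
      = (centralSeq p n ⁻¹' {z : Vec p | q < ‖z‖ ^ 2}).indicator (fun _ => 1) := by
    ext x
    rw [rayleighTest_eq]
    rfl
  rw [this, integral_indicator ((continuous_centralSeq p n).measurable ho.measurableSet)]
  simp [Measure.real]

/-! ### The moment generating function of the uniform distribution -/

theorem cosh_mul_cosh_add_eq (a d u v : ℝ) :
    Real.cosh (a * u) * Real.cosh (d * v) + Real.cosh (a * v) * Real.cosh (d * u)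
      = Real.cosh ((a + d) * ((u + v) / 2)) * Real.cosh ((a - d) * ((u - v) / 2))
        + Real.cosh ((a + d) * ((u - v) / 2)) * Real.cosh ((a - d) * ((u + v) / 2)) := by
  have h : ∀ x y : ℝ, Real.cosh x * Real.cosh y = (Real.cosh (x + y) + Real.cosh (x - y)) / 2 := by
    intro x y
    rw [Real.cosh_add, Real.cosh_sub]
    ring
  rw [h, h, h, h, ← Real.cosh_neg ((a + d) * ((u - v) / 2) - (a - d) * ((u + v) / 2))]
  ring_nf

/-- At a fixed product, spreading a pair apart increases both its sum and its difference, and the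
preceding identity writes the symmetrized product in terms of these two alone. -/
theorem cosh_mul_cosh_add_le {a b b' d : ℝ} (hd : 0 ≤ d) (hab : b ≤ a) (hab' : b' ≤ a)
    (hdb : d ≤ b) (hdb' : d ≤ b') (h : b * b' = a * d) (u v : ℝ) :
    Real.cosh (b * u) * Real.cosh (b' * v) + Real.cosh (b * v) * Real.cosh (b' * u)
      ≤ Real.cosh (a * u) * Real.cosh (d * v) + Real.cosh (a * v) * Real.cosh (d * u) := by
  have h1 : |b + b'| ≤ |a + d| := by
    rw [abs_of_nonneg (by linarith), abs_of_nonneg (by linarith)]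
    -- For `a > 0`, `(a - b)(a - b') ≥ 0` and `bb' = ad` give `a(b + b') ≤ a(a + d)`.
    rcases (hd.trans (hdb.trans hab)).eq_or_lt with ha | ha
    · linarith
    · nlinarith [mul_nonneg (sub_nonneg.2 hab) (sub_nonneg.2 hab')]
  have h2 : |b - b'| ≤ |a - d| := by
    rw [abs_of_nonneg (by linarith : 0 ≤ a - d), abs_le]
    constructor <;> linarith
  have hc : ∀ {x y : ℝ} (w : ℝ), |x| ≤ |y| → Real.cosh (x * w) ≤ Real.cosh (y * w) := by
    intro x y w hxy
    rw [Real.cosh_le_cosh, abs_mul, abs_mul]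
    exact mul_le_mul_of_nonneg_right hxy (abs_nonneg w)
  rw [cosh_mul_cosh_add_eq, cosh_mul_cosh_add_eq a d]
  exact add_le_add
    (mul_le_mul (hc _ h1) (hc _ h2) (Real.cosh_pos _).le (Real.cosh_pos _).le)
    (mul_le_mul (hc _ h1) (hc _ h2) (Real.cosh_pos _).le (Real.cosh_pos _).le)

/-- The mean of `cosh (r x'e)` under the uniform distribution. -/
def meanCosh (e : Vec p) (r : ℝ) : ℝ := ∫ x : Sph p, Real.cosh (r * ⟪(x : Vec p), e⟫) ∂(uniformSphere p)

theorem integrable_of_continuous_sph (hp : 2 ≤ p) {g : Sph p → ℝ} (hg : Continuous g) :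
    Integrable g (uniformSphere p) := by
  have := isProbabilityMeasure_uniformSphere hp
  obtain ⟨K, hK⟩ := isCompact_univ.exists_bound_of_continuousOn hg.continuousOn
  exact Integrable.of_bound hg.aestronglyMeasurable K (ae_of_all _ fun x => hK x trivial)

theorem integrable_cosh (hp : 2 ≤ p) (e : Vec p) (r : ℝ) :
    Integrable (fun x : Sph p => Real.cosh (r * ⟪(x : Vec p), e⟫)) (uniformSphere p) :=
  integrable_of_continuous_sph hp (by fun_prop)

/-- Integrate the pointwise inequality over two independent uniform points; each side then counts
its product twice. On positive arguments this is convexity of `log (meanCosh e (exp s))` in `s`,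
which makes `meanCosh e (t r) / meanCosh e (c r)` increasing in `r` for `c ≤ t`. -/
theorem meanCosh_mul_le (hp : 2 ≤ p) (e : Vec p) {a b b' d : ℝ} (hd : 0 ≤ d) (hab : b ≤ a)
    (hab' : b' ≤ a) (hdb : d ≤ b) (hdb' : d ≤ b') (h : b * b' = a * d) :
    meanCosh e b * meanCosh e b' ≤ meanCosh e a * meanCosh e d := by
  have h1 : ∀ v : ℝ, meanCosh e b * Real.cosh (b' * v) + Real.cosh (b * v) * meanCosh e b'
      ≤ meanCosh e a * Real.cosh (d * v) + Real.cosh (a * v) * meanCosh e d := by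
    intro v
    unfold meanCosh
    rw [← integral_mul_const, ← integral_const_mul, ← integral_mul_const, ← integral_const_mul,
      ← integral_add ((integrable_cosh hp e b).mul_const _) ((integrable_cosh hp e b').const_mul _),
      ← integral_add ((integrable_cosh hp e a).mul_const _) ((integrable_cosh hp e d).const_mul _)]
    exact integral_mono
      (((integrable_cosh hp e b).mul_const _).add ((integrable_cosh hp e b').const_mul _))
      (((integrable_cosh hp e a).mul_const _).add ((integrable_cosh hp e d).const_mul _))
      fun x => cosh_mul_cosh_add_le hd hab hab' hdb hdb' h _ _
  have h2 := integral_mono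
    (((integrable_cosh hp e b').const_mul (meanCosh e b)).add
      ((integrable_cosh hp e b).mul_const (meanCosh e b')))
    (((integrable_cosh hp e d).const_mul (meanCosh e a)).add
      ((integrable_cosh hp e a).mul_const (meanCosh e d)))
    fun x => h1 ⟪(x : Vec p), e⟫
  simp only [Pi.add_apply] at h2
  rw [integral_add ((integrable_cosh hp e b').const_mul _) ((integrable_cosh hp e b).mul_const _),
    integral_add ((integrable_cosh hp e d).const_mul _) ((integrable_cosh hp e a).mul_const _),
    integral_const_mul, integral_mul_const, integral_const_mul, integral_mul_const] at h2
  change meanCosh e b * meanCosh e b' + meanCosh e b * meanCosh e b'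
    ≤ meanCosh e a * meanCosh e d + meanCosh e a * meanCosh e d at h2
  linarith

theorem meanCosh_mono (hp : 2 ≤ p) (e : Vec p) {r r' : ℝ} (h0 : 0 ≤ r) (h : r ≤ r') :
    meanCosh e r ≤ meanCosh e r' := by
  refine integral_mono (integrable_cosh hp e r) (integrable_cosh hp e r') fun x => ?_
  simp only [Real.cosh_le_cosh, abs_mul]
  gcongr

theorem one_le_meanCosh (hp : 2 ≤ p) (e : Vec p) (r : ℝ) : 1 ≤ meanCosh e r := by
  have := isProbabilityMeasure_uniformSphere hp
  have h := integral_mono (integrable_const 1) (integrable_cosh hp e r)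
    fun x => Real.one_le_cosh _
  rwa [integral_const, probReal_univ, one_smul] at h

theorem meanCosh_pos (hp : 2 ≤ p) (e : Vec p) (r : ℝ) : 0 < meanCosh e r :=
  one_pos.trans_le (one_le_meanCosh hp e r)

theorem continuous_meanCosh (hp : 2 ≤ p) (e : Vec p) : Continuous (meanCosh e) := by
  have := isProbabilityMeasure_uniformSphere hp
  have h := continuous_parametric_integral_of_continuous (μ := uniformSphere p)
    (f := fun (r : ℝ) (x : Sph p) => Real.cosh (r * ⟪(x : Vec p), e⟫)) (by fun_prop)
    (s := Set.univ) isCompact_univ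
  simp only [Measure.restrict_univ] at h
  exact h

theorem integral_exp_inner_sph (hp : 2 ≤ p) {e : Vec p} (he : ‖e‖ = 1) (z : Vec p) :
    ∫ x : Sph p, Real.exp ⟪(x : Vec p), z⟫ ∂(uniformSphere p) = meanCosh e ‖z‖ := by
  have hi : Integrable (fun x : Sph p => Real.exp ⟪(x : Vec p), z⟫) (uniformSphere p) :=
    integrable_of_continuous_sph hp (by fun_prop)
  have hi' : Integrable (fun x : Sph p => Real.exp (-⟪(x : Vec p), z⟫)) (uniformSphere p) :=
    integrable_of_continuous_sph hp (by fun_prop)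
  have h1 : ∫ x : Sph p, Real.exp ⟪(x : Vec p), z⟫ ∂(uniformSphere p)
      = ∫ x : Sph p, Real.cosh ⟪(x : Vec p), z⟫ ∂(uniformSphere p) := by
    simp_rw [Real.cosh_eq]
    rw [integral_div, integral_add hi hi', integral_inner_neg Real.exp z]
    ring
  rw [h1, integral_inner_congr_norm Real.cosh (z' := ‖z‖ • e) (by simp [norm_smul, he])]
  simp_rw [real_inner_smul_right]
  rfl

/-! ### Power against spherical mixtures of the limiting shifts -/

theorem integrable_mul_of_isTest {n : ℕ} {φ g : Sample p n → ℝ} (hφ : IsTest φ)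
    (hg : Integrable g (nullLaw p n)) : Integrable (fun x => φ x * g x) (nullLaw p n) := by
  refine hg.bdd_mul hφ.measurable.aestronglyMeasurable (c := 1) (ae_of_all _ fun x => ?_)
  rw [Real.norm_eq_abs, abs_of_nonneg (hφ.nonneg x)]
  exact hφ.le_one x

theorem integrable_isTest (hp : 2 ≤ p) {n : ℕ} {φ : Sample p n → ℝ} (hφ : IsTest φ) :
    Integrable φ (nullLaw p n) := by
  have := isProbabilityMeasure_nullLaw hp n
  simpa using integrable_mul_of_isTest hφ (integrable_const (1 : ℝ))

theorem continuous_meanCosh_centralSeq (hp : 2 ≤ p) (e : Vec p) (t : ℝ) (n : ℕ) :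
    Continuous fun x : Sample p n => meanCosh e (t * ‖centralSeq p n x‖) :=
  (continuous_meanCosh hp e).comp (continuous_const.mul (continuous_centralSeq p n).norm)

/-- The average of the power of `φ` against the limiting shifts in all the directions. -/
def mixPower (e : Vec p) (n : ℕ) (t : ℝ) (φ : Sample p n → ℝ) : ℝ :=
  Real.exp (-(1 / 2 * t ^ 2)) * ∫ x, φ x * meanCosh e (t * ‖centralSeq p n x‖) ∂(nullLaw p n)

/-- Fubini, averaging over directions first. The unit vector `e` is only a reference direction:
`meanCosh e` does not depend on it. -/
theorem integral_integral_gaussLik (hp : 2 ≤ p) {e : Vec p} (he : ‖e‖ = 1) {n : ℕ} {t : ℝ}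
    (ht : 0 ≤ t) {φ : Sample p n → ℝ} (hφ : IsTest φ) :
    Integrable (fun u : Sph p => ∫ x, φ x * gaussLik p n (t • (u : Vec p)) x ∂(nullLaw p n))
        (uniformSphere p) ∧
      ∫ u : Sph p, ∫ x, φ x * gaussLik p n (t • (u : Vec p)) x ∂(nullLaw p n) ∂(uniformSphere p)
        = mixPower e n t φ := by
  have := isProbabilityMeasure_uniformSphere hp
  have := isProbabilityMeasure_nullLaw hp n
  have hc : Continuous fun y : Sph p × Sample p n => gaussLik p n (t • (y.1 : Vec p)) y.2 := by
    have h1 : Continuous fun y : Sph p × Sample p n => t • (y.1 : Vec p) := by fun_prop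
    have h2 : Continuous fun y : Sph p × Sample p n => centralSeq p n y.2 :=
      (continuous_centralSeq p n).comp continuous_snd
    unfold gaussLik
    exact Real.continuous_exp.comp ((h1.inner h2).sub (by fun_prop))
  obtain ⟨K, hK⟩ := isCompact_univ.exists_bound_of_continuousOn hc.continuousOn
  have hi : Integrable (fun y : Sph p × Sample p n => φ y.2 * gaussLik p n (t • (y.1 : Vec p)) y.2)
      ((uniformSphere p).prod (nullLaw p n)) := by
    refine Integrable.of_bound
      ((hφ.measurable.comp measurable_snd).mul hc.measurable).aestronglyMeasurable K
      (ae_of_all _ fun y => ?_)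
    rw [norm_mul, Real.norm_eq_abs, abs_of_nonneg (hφ.nonneg _)]
    refine (mul_le_mul (hφ.le_one _) (hK y trivial) (norm_nonneg _) zero_le_one).trans (one_mul K).le
  refine ⟨hi.integral_prod_left, ?_⟩
  rw [integral_integral_swap hi, mixPower, ← integral_const_mul]
  refine integral_congr_ae (ae_of_all _ fun x => ?_)
  simp only
  have h3 : ∀ u : Sph p, gaussLik p n (t • (u : Vec p)) x
      = Real.exp ⟪(u : Vec p), t • centralSeq p n x⟫ * Real.exp (-(1 / 2 * t ^ 2)) := by
    intro u
    rw [gaussLik, ← Real.exp_add, real_inner_smul_left, real_inner_smul_right, norm_smul,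
      norm_eq_of_mem_sphere, mul_one, Real.norm_eq_abs, sq_abs, sub_eq_add_neg]
  simp_rw [h3]
  rw [integral_const_mul, integral_mul_const, integral_exp_inner_sph hp he, norm_smul,
    Real.norm_eq_abs, abs_of_nonneg ht]
  ring

theorem exists_integral_gaussLik_le (hp : 2 ≤ p) {e : Vec p} (he : ‖e‖ = 1) {n : ℕ} {t : ℝ}
    (ht : 0 ≤ t) {φ : Sample p n → ℝ} (hφ : IsTest φ) :
    ∃ τ : Vec p, ‖τ‖ = t ∧
      ∫ x, φ x * gaussLik p n τ x ∂(nullLaw p n) ≤ mixPower e n t φ := by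
  have := isProbabilityMeasure_uniformSphere hp
  obtain ⟨h1, h2⟩ := integral_integral_gaussLik hp he ht hφ
  obtain ⟨u, hu⟩ := exists_le_integral h1
  refine ⟨t • (u : Vec p), ?_, hu.trans h2.le⟩
  rw [norm_smul, norm_eq_of_mem_sphere, mul_one, Real.norm_eq_abs, abs_of_nonneg ht]

/-- Rotating the sample shows that an invariant test has the same power in every direction, hence
equal to the average. -/
theorem integral_gaussLik_eq_mixPower (hp : 2 ≤ p) {e : Vec p} (he : ‖e‖ = 1) {n : ℕ}
    {φ : Sample p n → ℝ} (hφ : IsTest φ)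
    (hinv : ∀ (R : Vec p ≃ₗᵢ[ℝ] Vec p) x, φ (sampleRot R x) = φ x) (τ : Vec p) :
    ∫ x, φ x * gaussLik p n τ x ∂(nullLaw p n) = mixPower e n ‖τ‖ φ := by
  have := isProbabilityMeasure_uniformSphere hp
  rw [← (integral_integral_gaussLik hp he (norm_nonneg τ) hφ).2]
  have h : ∀ u : Sph p, ∫ x, φ x * gaussLik p n (‖τ‖ • (u : Vec p)) x ∂(nullLaw p n)
      = ∫ x, φ x * gaussLik p n τ x ∂(nullLaw p n) := by
    intro u
    obtain ⟨R, hR⟩ := exists_isometry_of_norm_eq (z := τ) (z' := ‖τ‖ • (u : Vec p))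
      (by simp [norm_smul])
    rw [← (measurePreserving_sampleRot hp n R).integral_comp (sampleRot R).measurableEmbedding]
    refine integral_congr_ae (ae_of_all _ fun x => ?_)
    simp only [hinv, gaussLik, centralSeq_sampleRot]
    rw [← hR, LinearIsometryEquiv.inner_map_map, LinearIsometryEquiv.norm_map]
  simp_rw [h]
  simp

theorem rayleighTest_sampleRot (α : ℝ) (n : ℕ) (R : Vec p ≃ₗᵢ[ℝ] Vec p) (x : Sample p n) :
    rayleighTest p α n (sampleRot R x) = rayleighTest p α n x := by
  simp [rayleighTest_eq, Set.indicator_apply]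

theorem isTest_one {n : ℕ} : IsTest (fun _ : Sample p n => (1 : ℝ)) :=
  ⟨measurable_const, fun _ => zero_le_one, fun _ => le_rfl⟩

theorem rayleighTest_cases (hp : 2 ≤ p) {α : ℝ} (h0 : 0 < α) (h1 : α < 1) (n : ℕ)
    (x : Sample p n) :
    (rayleighTest p α n x = 1 ∧ √(chiSqQuantile p (1 - α)) ≤ ‖centralSeq p n x‖) ∨
    (rayleighTest p α n x = 0 ∧ ‖centralSeq p n x‖ ≤ √(chiSqQuantile p (1 - α))) := by
  have hq := chiSqQuantile_nonneg hp (u := 1 - α) (by linarith) (by linarith)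
  rw [rayleighTest_eq, Set.indicator_apply]
  by_cases h : chiSqQuantile p (1 - α) < ‖centralSeq p n x‖ ^ 2
  · left
    exact ⟨if_pos h, (Real.sqrt_le_left (norm_nonneg _)).2 h.le⟩
  · right
    exact ⟨if_neg h, Real.le_sqrt_of_sq_le (not_lt.1 h)⟩

/-- The Neyman-Pearson inequality for the Rayleigh test. -/
theorem integral_mul_meanCosh_le (hp : 2 ≤ p) {α : ℝ} (h0 : 0 < α) (h1 : α < 1) (e : Vec p)
    {n : ℕ} {c : ℝ} (hc : 0 ≤ c) {ψ : Sample p n → ℝ} (hψ : IsTest ψ) :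
    ∫ x, ψ x * meanCosh e (c * ‖centralSeq p n x‖) ∂(nullLaw p n)
      ≤ ∫ x, rayleighTest p α n x * meanCosh e (c * ‖centralSeq p n x‖) ∂(nullLaw p n)
        + meanCosh e (c * √(chiSqQuantile p (1 - α)))
          * (∫ x, ψ x ∂(nullLaw p n) - ∫ x, rayleighTest p α n x ∂(nullLaw p n)) := by
  set s := √(chiSqQuantile p (1 - α))
  have hs : 0 ≤ s := Real.sqrt_nonneg _
  have hφ := isTest_rayleighTest (p := p) α n
  have hW := integrable_of_continuous hp (continuous_meanCosh_centralSeq hp e c n)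
  have i1 := integrable_mul_of_isTest hψ hW
  have i2 := integrable_mul_of_isTest hφ hW
  have i3 : Integrable (fun x => ψ x - rayleighTest p α n x) (nullLaw p n) :=
    (integrable_isTest hp hψ).sub (integrable_isTest hp hφ)
  rw [← integral_sub (integrable_isTest hp hψ) (integrable_isTest hp hφ), ← integral_const_mul,
    ← integral_add i2 (i3.const_mul _)]
  refine integral_mono i1 (i2.add (i3.const_mul _)) fun x => ?_
  simp only
  -- Neyman-Pearson pointwise: `ψ - φ` and the weight minus its value at the threshold have opposite
  -- signs, by monotonicity of `meanCosh`.
  rcases rayleighTest_cases hp h0 h1 n x with ⟨hx, hle⟩ | ⟨hx, hle⟩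
  · have := meanCosh_mono hp e (mul_nonneg hc hs) (mul_le_mul_of_nonneg_left hle hc)
    rw [hx]
    nlinarith [hψ.le_one x]
  · have := meanCosh_mono hp e (mul_nonneg hc (norm_nonneg _)) (mul_le_mul_of_nonneg_left hle hc)
    rw [hx]
    nlinarith [hψ.nonneg x]

/-- The normalized power of the Rayleigh test against spherical mixtures increases with the
radius. -/
theorem mixPower_mul_le (hp : 2 ≤ p) {α : ℝ} (h0 : 0 < α) (h1 : α < 1) (e : Vec p)
    {n : ℕ} {c t : ℝ} (hc : 0 ≤ c) (hct : c ≤ t) :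
    mixPower e n c (rayleighTest p α n) * mixPower e n t (fun _ => 1)
      ≤ mixPower e n t (rayleighTest p α n) * mixPower e n c (fun _ => 1) := by
  set s := √(chiSqQuantile p (1 - α))
  have hs : 0 ≤ s := Real.sqrt_nonneg _
  have ht := hc.trans hct
  have hφ := isTest_rayleighTest (p := p) α n
  have hWc := integrable_of_continuous hp (continuous_meanCosh_centralSeq hp e c n)
  have hWt := integrable_of_continuous hp (continuous_meanCosh_centralSeq hp e t n)
  have ic := integrable_mul_of_isTest hφ hWc
  have it := integrable_mul_of_isTest hφ hWt
  set Ac := ∫ x, rayleighTest p α n x * meanCosh e (c * ‖centralSeq p n x‖) ∂(nullLaw p n)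
  set At := ∫ x, rayleighTest p α n x * meanCosh e (t * ‖centralSeq p n x‖) ∂(nullLaw p n)
  set Nc := ∫ x, meanCosh e (c * ‖centralSeq p n x‖) ∂(nullLaw p n)
  set Nt := ∫ x, meanCosh e (t * ‖centralSeq p n x‖) ∂(nullLaw p n)
  have hmc := meanCosh_pos hp e (c * s)
  have hmt := meanCosh_pos hp e (t * s)
  -- Beyond the threshold the ratio of the weights at `t` and `c` is at least its value at `s`;
  -- below it (`hB`) it is at most that value.
  have hA : meanCosh e (t * s) * Ac ≤ meanCosh e (c * s) * At := by
    rw [← integral_const_mul, ← integral_const_mul]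
    refine integral_mono (ic.const_mul _) (it.const_mul _) fun x => ?_
    simp only
    rcases rayleighTest_cases hp h0 h1 n x with ⟨hx, hle⟩ | ⟨hx, hle⟩
    · rw [hx, one_mul, one_mul, mul_comm (meanCosh e (c * s))]
      refine meanCosh_mul_le hp e (mul_nonneg hc hs) ?_ ?_ ?_ ?_ (by ring) <;> gcongr
    · rw [hx]
      simp
  have hB : meanCosh e (c * s) * (Nt - At) ≤ meanCosh e (t * s) * (Nc - Ac) := by
    rw [← integral_sub hWt it, ← integral_sub hWc ic, ← integral_const_mul, ← integral_const_mul]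
    refine integral_mono ((hWt.sub it).const_mul _) ((hWc.sub ic).const_mul _) fun x => ?_
    simp only
    rcases rayleighTest_cases hp h0 h1 n x with ⟨hx, hle⟩ | ⟨hx, hle⟩
    · rw [hx]
      simp
    · rw [hx, zero_mul, zero_mul, sub_zero, sub_zero, mul_comm (meanCosh e (c * s))]
      have : 0 ≤ ‖centralSeq p n x‖ := norm_nonneg _
      refine meanCosh_mul_le hp e (mul_nonneg hc this) ?_ ?_ ?_ ?_ (by ring) <;> gcongr
  have hAc : 0 ≤ Ac := integral_nonneg fun x => mul_nonneg (hφ.nonneg x) (meanCosh_pos hp e _).le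
  have hcc : 0 ≤ Nc - Ac := by
    rw [← integral_sub hWc ic]
    refine integral_nonneg fun x => ?_
    simp only [Pi.zero_apply]
    nlinarith [hφ.le_one x, meanCosh_pos hp e (c * ‖centralSeq p n x‖)]
  -- Chaining `hA` and `hB` eliminates the threshold values; the common term `Ac * At` is then added
  -- back.
  have key : Ac * Nt ≤ At * Nc := by
    have e1 : Ac * (Nt - At) ≤ At * (Nc - Ac) := by
      refine le_of_mul_le_mul_left ?_ hmc
      calc meanCosh e (c * s) * (Ac * (Nt - At)) = Ac * (meanCosh e (c * s) * (Nt - At)) := by ring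
        _ ≤ Ac * (meanCosh e (t * s) * (Nc - Ac)) := by gcongr
        _ = (meanCosh e (t * s) * Ac) * (Nc - Ac) := by ring
        _ ≤ (meanCosh e (c * s) * At) * (Nc - Ac) := by gcongr
        _ = _ := by ring
    linarith
  unfold mixPower
  simp only [one_mul]
  calc _ = Real.exp (-(1 / 2 * c ^ 2)) * Real.exp (-(1 / 2 * t ^ 2)) * (Ac * Nt) := by ring
    _ ≤ Real.exp (-(1 / 2 * c ^ 2)) * Real.exp (-(1 / 2 * t ^ 2)) * (At * Nc) := by gcongr
    _ = _ := by ring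

/-! ### Transfer between the actual alternatives and the Gaussian shifts -/

theorem abs_integral_mul_lik_sub_le (hp : 2 ≤ p) (hf : IsAngularFunction f) {n : ℕ} {τ : Vec p}
    {ε : ℝ} (h : ∫ x, |lik p n f (√((p : ℝ) / n) • τ) x - gaussLik p n τ x| ∂(nullLaw p n) ≤ ε)
    {φ : Sample p n → ℝ} (hφ : IsTest φ) :
    |∫ x, φ x ∂(localLaw p n f τ) - ∫ x, φ x * gaussLik p n τ x ∂(nullLaw p n)| ≤ ε := by
  have hL := integrable_lik hp hf n (√((p : ℝ) / n) • τ)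
  have hG := integrable_of_continuous hp (continuous_gaussLik n τ)
  rw [localLaw, integral_muLaw hp hf, ← integral_sub (integrable_mul_of_isTest hφ hL)
    (integrable_mul_of_isTest hφ hG)]
  refine (abs_integral_le_integral_abs).trans (le_trans ?_ h)
  refine integral_mono ((integrable_mul_of_isTest hφ hL).sub
    (integrable_mul_of_isTest hφ hG)).abs (hL.sub hG).abs fun x => ?_
  simp only
  rw [← mul_sub, abs_mul, abs_of_nonneg (hφ.nonneg x)]
  exact mul_le_of_le_one_left (abs_nonneg _) (hφ.le_one x)

/-- The constant test has power one under the actual alternative, so `L¹` closeness forces the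
Gaussian likelihood to have mass near one, uniformly on bounded radii. -/
theorem eventually_abs_mixPower_one_sub_le (hp : 2 ≤ p) (hf : IsAngularFunction f)
    (hf2 : TwiceDifferentiableAt f 0) {e : Vec p} (he : ‖e‖ = 1) (M : ℝ) {ε : ℝ} (hε : 0 < ε) :
    ∀ᶠ n : ℕ in atTop, ∀ t, 0 ≤ t → t ≤ M → |mixPower e n t (fun _ => 1) - 1| ≤ ε := by
  filter_upwards [eventually_integral_abs_lik_sub_le hp hf hf2 M hε] with n h t ht htM
  have hte : ‖t • e‖ = t := by rw [norm_smul, he, mul_one, Real.norm_eq_abs, abs_of_nonneg ht]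
  have h1 := abs_integral_mul_lik_sub_le hp hf (h (t • e) (by rwa [hte])) isTest_one
  have := isProbabilityMeasure_muLaw hp hf n (√((p : ℝ) / n) • (t • e))
  rw [integral_gaussLik_eq_mixPower hp he isTest_one (fun _ _ => rfl), hte, localLaw] at h1
  simp only [integral_const, probReal_univ, one_smul] at h1
  rwa [abs_sub_comm]

/-- The weight `W(r)`, `r = ‖Δ‖`, is not a bounded function of `Δ`, but `φW(r) = W(r) + W(s)φ -
W(min(r, s))` with `s` the threshold. The three means converge by normalization, by asymptotic size
and by weak convergence, so uniform integrability is not needed. The value of the limit is never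
used. -/
theorem exists_tendsto_mixPower_rayleighTest (hp : 2 ≤ p) (hf : IsAngularFunction f)
    (hf2 : TwiceDifferentiableAt f 0) {e : Vec p} (he : ‖e‖ = 1) {α : ℝ} (h0 : 0 < α) (h1 : α < 1)
    {c : ℝ} (hc : 0 ≤ c) :
    ∃ β, Tendsto (fun n => mixPower e n c (rayleighTest p α n)) atTop (𝓝 β) := by
  set s := √(chiSqQuantile p (1 - α))
  have hs : 0 ≤ s := Real.sqrt_nonneg _
  have t1 : Tendsto (fun n => mixPower e n c (fun _ => 1)) atTop (𝓝 1) := by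
    rw [Metric.tendsto_nhds]
    intro ε hε
    filter_upwards [eventually_abs_mixPower_one_sub_le hp hf hf2 he c (half_pos hε)] with n hn
    exact (hn c hc le_rfl).trans_lt (by linarith)
  have t2 := tendsto_integral_rayleighTest hp h0 h1
  have hgc : Continuous fun z : Vec p => meanCosh e (c * min ‖z‖ s) :=
    (continuous_meanCosh hp e).comp (by fun_prop)
  have t3 := tendsto_integral_centralSeq hp hgc (K := meanCosh e (c * s)) fun z => by
    rw [abs_of_pos (meanCosh_pos hp e _)]
    exact meanCosh_mono hp e (mul_nonneg hc (le_min (norm_nonneg _) hs))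
      (mul_le_mul_of_nonneg_left (min_le_right _ _) hc)
  refine ⟨_, (t1.add ((t2.const_mul (meanCosh e (c * s))).sub t3 |>.const_mul
    (Real.exp (-(1 / 2 * c ^ 2))))).congr fun n => ?_⟩
  have hφ := isTest_rayleighTest (p := p) α n
  have hW := integrable_of_continuous hp (continuous_meanCosh_centralSeq hp e c n)
  have hg := integrable_of_continuous hp (hgc.comp (continuous_centralSeq p n))
  have hφi := (integrable_isTest hp hφ).const_mul (meanCosh e (c * s))
  unfold mixPower
  simp only [one_mul]
  rw [← mul_add, ← integral_const_mul]
  have hg' : Integrable (fun x => meanCosh e (c * min ‖centralSeq p n x‖ s)) (nullLaw p n) := hg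
  have hd : Integrable (fun x => meanCosh e (c * s) * rayleighTest p α n x
      - meanCosh e (c * min ‖centralSeq p n x‖ s)) (nullLaw p n) := hφi.sub hg'
  rw [← integral_sub hφi hg', ← integral_add hW hd]
  congr 1
  refine integral_congr_ae (ae_of_all _ fun x => ?_)
  simp only
  rcases rayleighTest_cases hp h0 h1 n x with ⟨hx, hle⟩ | ⟨hx, hle⟩
  · rw [hx, min_eq_right hle]
    ring
  · rw [hx, min_eq_left hle]
    ring

/-! ### Consistency of the Rayleigh test against remote alternatives -/

/-- Near `0` the derivative gives `f(x) - f(-x) ≥ x`, while the sum is at most `2f(1)`. Away from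
`0`, monotonicity keeps `f(-x)/f(x)` below a constant less than one, whatever the growth of `f`. -/
theorem IsAngularFunction.exists_mul_add_le_sub (hf : IsAngularFunction f) :
    ∃ C > 0, ∀ x, 0 ≤ x → C * min x 1 * (f x + f (-x)) ≤ f x - f (-x) := by
  have h1 := hf.hasDerivAt_zero.isLittleO.def (c := 1 / 2) (by norm_num)
  obtain ⟨δ, hδ, hball⟩ := Metric.eventually_nhds_iff.1 h1
  set x₀ := min (δ / 2) 1
  have hx₀ : 0 < x₀ := by positivity
  have hlin : ∀ y, |y| ≤ x₀ → |f y - 1 - y| ≤ 1 / 2 * |y| := by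
    intro y hy
    have := hball (y := y) (by
      rw [Real.dist_eq, sub_zero]
      exact (hy.trans (min_le_left _ _)).trans_lt (by linarith))
    simpa [hf.map_zero] using this
  have hK : 0 < f 1 := hf.pos 1
  set r := f (-x₀) / f x₀ with hr
  have hr1 : r < 1 := (div_lt_one (hf.pos _)).2 (hf.strictMono (by linarith))
  refine ⟨min (1 / (2 * f 1)) ((1 - r) / 2), lt_min (by positivity) (by linarith), fun x hx => ?_⟩
  set C := min (1 / (2 * f 1)) ((1 - r) / 2)
  have hC0 : 0 ≤ C := le_min (by positivity) (by linarith)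
  have hS : 0 < f x + f (-x) := add_pos (hf.pos _) (hf.pos _)
  have hmin : 0 ≤ min x 1 := le_min hx zero_le_one
  rcases le_total x x₀ with h | h
  · have hx1 : x ≤ 1 := h.trans (min_le_right _ _)
    have e1 := hlin x (by rwa [abs_of_nonneg hx])
    have e2 := hlin (-x) (by rwa [abs_neg, abs_of_nonneg hx])
    rw [abs_neg] at e2
    rw [abs_of_nonneg hx] at e1 e2
    have e3 := (abs_le.1 e1).1
    have e4 := (abs_le.1 e2).2
    have e5 : f x + f (-x) ≤ 2 * f 1 := by
      have := hf.strictMono.monotone hx1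
      have := hf.strictMono.monotone (by linarith : -x ≤ 1)
      linarith
    calc C * min x 1 * (f x + f (-x)) ≤ 1 / (2 * f 1) * x * (2 * f 1) :=
          mul_le_mul (mul_le_mul (min_le_left _ _) (min_le_left _ _) hmin (by positivity)) e5 hS.le
            (by positivity)
      _ = x := by field_simp
      _ ≤ f x - f (-x) := by linarith
  · have e1 : f (-x) ≤ r * f x := by
      have h2 : f (-x) ≤ f (-x₀) := hf.strictMono.monotone (by linarith)
      have h3 : f x₀ ≤ f x := hf.strictMono.monotone h
      have h4 : f (-x₀) = r * f x₀ := by rw [hr, div_mul_cancel₀ _ (hf.pos _).ne']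
      have h5 : 0 ≤ r := div_nonneg (hf.nonneg _) (hf.nonneg _)
      calc f (-x) ≤ r * f x₀ := h2.trans h4.le
        _ ≤ r * f x := mul_le_mul_of_nonneg_left h3 h5
    have e2 : f (-x) ≤ f x := hf.strictMono.monotone (by linarith)
    calc C * min x 1 * (f x + f (-x)) ≤ (1 - r) / 2 * 1 * (2 * f x) :=
          mul_le_mul (mul_le_mul (min_le_right _ _) (min_le_right _ _) hmin (by linarith))
            (by linarith) hS.le (by linarith)
      _ = f x - r * f x := by ring
      _ ≤ _ := by linarith

/-- Pairing `u` with `-u`, the preceding lemma bounds the integrand below by a multiple of `u²(f(κu)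
+ f(-κu))`. The factor `u²` is then replaced by its mean `1/p` through an association inequality:
`u²` and `f(κu)` both increase on `u ≥ 0`. All constants are uniform in `κ`. -/
theorem exists_mul_integral_le_integral_inner_mul (hp : 2 ≤ p) (hf : IsAngularFunction f) :
    ∃ C > 0, ∀ θ : Vec p, ‖θ‖ = 1 → ∀ κ, 0 ≤ κ →
      C * min κ 1 * ∫ x : Sph p, f (κ * ⟪(x : Vec p), θ⟫) ∂(uniformSphere p)
        ≤ ∫ x : Sph p, ⟪(x : Vec p), θ⟫ * f (κ * ⟪(x : Vec p), θ⟫) ∂(uniformSphere p) := by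
  have := isProbabilityMeasure_uniformSphere hp
  obtain ⟨C, hC, H⟩ := hf.exists_mul_add_le_sub
  have hp0 : (0 : ℝ) < p := by positivity
  refine ⟨C / (2 * p), by positivity, fun θ hθ κ hκ => ?_⟩
  set m : ℝ := 1 / p
  have hm : 0 < m := by positivity
  have hmono := hf.strictMono.monotone
  have hfm := hf.measurable
  have hbf : ∀ u : ℝ, |u| ≤ ‖θ‖ → |f (κ * u)| ≤ f κ := by
    intro u hu
    rw [abs_of_pos (hf.pos _)]
    refine hmono ?_
    rw [hθ] at hu
    nlinarith [le_abs_self u]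
  have i1 : Integrable (fun x : Sph p => f (κ * ⟪(x : Vec p), θ⟫)) (uniformSphere p) :=
    integrable_inner_of_bdd (G := fun u => f (κ * u)) (by fun_prop) θ hbf
  have i2 : Integrable (fun x : Sph p => f (κ * -⟪(x : Vec p), θ⟫)) (uniformSphere p) :=
    integrable_inner_of_bdd (G := fun u => f (κ * -u)) (by fun_prop) θ
      fun u hu => hbf (-u) (by rwa [abs_neg])
  have i3 : Integrable (fun x : Sph p => ⟪(x : Vec p), θ⟫ * f (κ * ⟪(x : Vec p), θ⟫))
      (uniformSphere p) :=
    integrable_inner_of_bdd (G := fun u => u * f (κ * u)) (by fun_prop) θ (K := 1 * f κ)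
      fun u hu => by
        rw [abs_mul]
        exact mul_le_mul (hu.trans hθ.le) (hbf u hu) (abs_nonneg _) zero_le_one
  have i4 : Integrable (fun x : Sph p => -⟪(x : Vec p), θ⟫ * f (κ * -⟪(x : Vec p), θ⟫))
      (uniformSphere p) :=
    integrable_inner_of_bdd (G := fun u => -u * f (κ * -u)) (by fun_prop) θ (K := 1 * f κ)
      fun u hu => by
        rw [abs_mul]
        exact mul_le_mul ((abs_neg u).le.trans (hu.trans hθ.le)) (hbf (-u) (by rwa [abs_neg]))
          (abs_nonneg _) zero_le_one
  have i5 : Integrable (fun x : Sph p => ⟪(x : Vec p), θ⟫ ^ 2 - m) (uniformSphere p) :=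
    integrable_of_continuous_sph hp (by fun_prop)
  have i6 : Integrable (fun x : Sph p => ⟪(x : Vec p), θ⟫ ^ 2) (uniformSphere p) :=
    integrable_of_continuous_sph hp (by fun_prop)
  set F₀ := f (κ * √m)
  have hpt : ∀ u : ℝ, |u| ≤ 1 → C * min κ 1 * (m / 2 * (f (κ * u) + f (κ * -u)) + (u ^ 2 - m) * F₀)
      ≤ u * f (κ * u) + -u * f (κ * -u) := by
    have hnn : ∀ u : ℝ, 0 ≤ u → u ≤ 1 →
        C * min κ 1 * (m / 2 * (f (κ * u) + f (κ * -u)) + (u ^ 2 - m) * F₀)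
          ≤ u * f (κ * u) + -u * f (κ * -u) := by
      intro u hu0 hu1
      have a1 := H (κ * u) (mul_nonneg hκ hu0)
      rw [← mul_neg] at a1
      have hk : 0 ≤ min κ 1 := le_min hκ zero_le_one
      have a2 : min κ 1 * u ≤ min (κ * u) 1 := by
        refine le_min (mul_le_mul_of_nonneg_right (min_le_left _ _) hu0) ?_
        exact mul_le_one₀ (min_le_right _ _) hu0 hu1
      have hpos := hf.pos (κ * u)
      have hneg := hf.pos (κ * -u)
      have a3 : C * (min κ 1 * u) * (f (κ * u) + f (κ * -u)) ≤ f (κ * u) - f (κ * -u) := by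
        refine le_trans ?_ a1
        gcongr
      have a4 : f (κ * -u) ≤ f (κ * u) := hmono (by nlinarith)
      -- Both factors change sign at `u = √m`; since `u² - m` has mean zero, the term in `F₀`
      -- disappears on integration.
      have a5 : 0 ≤ (u ^ 2 - m) * (f (κ * u) - F₀) := by
        rcases le_total (√m) u with h | h
        · have b1 : m ≤ u ^ 2 := by
            rw [← Real.sq_sqrt hm.le]; exact pow_le_pow_left₀ (Real.sqrt_nonneg _) h 2
          have b2 : F₀ ≤ f (κ * u) := hmono (mul_le_mul_of_nonneg_left h hκ)
          exact mul_nonneg (by linarith) (by linarith)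
        · have b1 : u ^ 2 ≤ m := by
            rw [← Real.sq_sqrt hm.le]; exact pow_le_pow_left₀ hu0 h 2
          have b2 : f (κ * u) ≤ F₀ := hmono (mul_le_mul_of_nonneg_left h hκ)
          exact mul_nonneg_of_nonpos_of_nonpos (by linarith) (by linarith)
      have a6 : m / 2 * (f (κ * u) + f (κ * -u)) + (u ^ 2 - m) * F₀
          ≤ u ^ 2 * (f (κ * u) + f (κ * -u)) := by
        have c1 : m / 2 * (f (κ * u) + f (κ * -u)) ≤ m * f (κ * u) := by nlinarith
        have c2 : 0 ≤ u ^ 2 * f (κ * -u) := by positivity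
        nlinarith
      calc _ ≤ C * min κ 1 * (u ^ 2 * (f (κ * u) + f (κ * -u))) := by gcongr
        _ = u * (C * (min κ 1 * u) * (f (κ * u) + f (κ * -u))) := by ring
        _ ≤ u * (f (κ * u) - f (κ * -u)) := by gcongr
        _ = _ := by ring
    intro u hu
    rcases le_total 0 u with h | h
    · exact hnn u h ((le_abs_self u).trans hu)
    · have := hnn (-u) (by linarith) ((neg_le_abs u).trans hu)
      rw [neg_neg, neg_sq, add_comm (f (κ * -u)), add_comm (-u * f (κ * -u))] at this
      exact this
  have hint := integral_mono
    ((((i1.add i2).const_mul (m / 2)).add (i5.mul_const F₀)).const_mul (C * min κ 1))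
    (i3.add i4) fun x => hpt _ ((abs_inner_sph_le x θ).trans hθ.le)
  have j1 : ∫ x : Sph p, (⟪(x : Vec p), θ⟫ ^ 2 - m) ∂(uniformSphere p) = 0 := by
    rw [integral_sub i6 (integrable_const _), integral_inner_sq_sph hp, hθ]
    simp [m]
  have j2 := integral_inner_neg (fun u => f (κ * u)) θ
  have j3 := integral_inner_neg (fun u => u * f (κ * u)) θ
  have l1 : ∫ x : Sph p, (C * min κ 1 * (m / 2 * (f (κ * ⟪(x : Vec p), θ⟫)
      + f (κ * -⟪(x : Vec p), θ⟫)) + (⟪(x : Vec p), θ⟫ ^ 2 - m) * F₀)) ∂(uniformSphere p)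
      = C * min κ 1 * (m * ∫ x : Sph p, f (κ * ⟪(x : Vec p), θ⟫) ∂(uniformSphere p)) := by
    have k1 : Integrable (fun x : Sph p => m / 2 * (f (κ * ⟪(x : Vec p), θ⟫)
      + f (κ * -⟪(x : Vec p), θ⟫))) (uniformSphere p) := (i1.add i2).const_mul _
    rw [integral_const_mul, integral_add k1 (i5.mul_const F₀), integral_const_mul,
      integral_add i1 i2, integral_mul_const, j1, j2]
    ring
  have l2 : ∫ x : Sph p, (⟪(x : Vec p), θ⟫ * f (κ * ⟪(x : Vec p), θ⟫)
      + -⟪(x : Vec p), θ⟫ * f (κ * -⟪(x : Vec p), θ⟫)) ∂(uniformSphere p)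
      = 2 * ∫ x : Sph p, ⟪(x : Vec p), θ⟫ * f (κ * ⟪(x : Vec p), θ⟫) ∂(uniformSphere p) := by
    rw [integral_add i3 i4, j3]
    ring
  have hfin := l1.symm.le.trans (hint.trans l2.le)
  have e : C / (2 * p) * min κ 1 = C * min κ 1 * m / 2 := by simp only [m]; ring
  rw [e]
  linarith

theorem integral_rotSym (hp : 2 ≤ p) (hf : IsAngularFunction f) (μ : Vec p) (g : Sph p → ℝ) :
    ∫ x, g x ∂(rotSym p (‖μ‖⁻¹ • μ) ‖μ‖ f) = ∫ x, g x * lik1 p f μ x ∂(uniformSphere p) := by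
  rw [rotSym_eq hp hf, integral_withDensity_eq_integral_toReal_smul
    (measurable_lik1 hf μ).ennreal_ofReal (ae_of_all _ fun x => ENNReal.ofReal_lt_top)]
  refine integral_congr_ae (ae_of_all _ fun x => ?_)
  simp only [smul_eq_mul, ENNReal.toReal_ofReal (lik1_pos hp hf μ x).le, mul_comm]

theorem exists_mul_min_le_integral_rotSym (hp : 2 ≤ p) (hf : IsAngularFunction f) :
    ∃ C > 0, ∀ μ : Vec p, μ ≠ 0 →
      C * min ‖μ‖ 1 ≤ ∫ x : Sph p, ⟪(x : Vec p), ‖μ‖⁻¹ • μ⟫ ∂(rotSym p (‖μ‖⁻¹ • μ) ‖μ‖ f) := by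
  obtain ⟨C, hC, H⟩ := exists_mul_integral_le_integral_inner_mul hp hf
  refine ⟨C, hC, fun μ hμ => ?_⟩
  have hμ0 : ‖μ‖ ≠ 0 := norm_ne_zero_iff.2 hμ
  have h := H (‖μ‖⁻¹ • μ) (by rw [norm_smul, norm_inv, norm_norm, inv_mul_cancel₀ hμ0]) ‖μ‖
    (norm_nonneg μ)
  have hin : ∀ x : Sph p, ‖μ‖ * ⟪(x : Vec p), ‖μ‖⁻¹ • μ⟫ = ⟪(x : Vec p), μ⟫ := by
    intro x
    rw [real_inner_smul_right, ← mul_assoc, mul_inv_cancel₀ hμ0, one_mul]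
  simp_rw [hin] at h
  rw [integral_rotSym hp hf]
  unfold lik1
  simp_rw [← mul_div_assoc]
  rw [integral_div, le_div_iff₀ (meanAng_pos hp hf μ)]
  exact h

/-- Project on `θ`: the sum of the `X_i'θ` has variance at most `n` and mean at least `√n D`, while
acceptance keeps it below `√n s`. Chebyshev's inequality then bounds the acceptance probability,
with `M` and the range of `n` independent of `τ`. -/
theorem exists_integral_rayleighTest_ge (hp : 2 ≤ p) (hf : IsAngularFunction f) {α : ℝ}
    (h0 : 0 < α) (h1 : α < 1) {ε : ℝ} (hε : 0 < ε) :
    ∃ M, ∀ᶠ n : ℕ in atTop, ∀ τ : Vec p, M ≤ ‖τ‖ →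
      1 - ε ≤ ∫ x, rayleighTest p α n x ∂(localLaw p n f τ) := by
  obtain ⟨C, hC, H⟩ := exists_mul_min_le_integral_rotSym hp hf
  set s := √(chiSqQuantile p (1 - α))
  have hs : 0 ≤ s := Real.sqrt_nonneg _
  have hp0 : (0 : ℝ) < p := by positivity
  have hp1 : 1 ≤ √(p : ℝ) := Real.one_le_sqrt.2 (by exact_mod_cast (by omega : 1 ≤ p))
  set B := 1 / √ε
  have hB : 0 < B := by positivity
  set D := B + s
  have hD : 0 < D := by positivity
  have hsq : Tendsto (fun n : ℕ => √(n : ℝ)) atTop atTop :=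
    Real.tendsto_sqrt_atTop.comp tendsto_natCast_atTop_atTop
  -- Since `√n min(‖μ‖, 1) = min(√p‖τ‖, √n)`, both `‖τ‖` and `√n` must reach `D/C`. In `D = B + s`,
  -- `B = 1/√ε` is the deviation for which Chebyshev's bound equals `ε`.
  refine ⟨D / C, ?_⟩
  filter_upwards [hsq.eventually_ge_atTop (D / C), eventually_gt_atTop 0] with n hnD hn τ hτ
  have hn0 : (0 : ℝ) < n := by positivity
  have hsn : 0 < √(n : ℝ) := by positivity
  have hτ0 : 0 < ‖τ‖ := lt_of_lt_of_le (by positivity) hτ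
  have hcoef : 0 < √((p : ℝ) / n) := by positivity
  set μ := √((p : ℝ) / n) • τ with hμdef
  have hμn : ‖μ‖ = √((p : ℝ) / n) * ‖τ‖ := by
    rw [hμdef, norm_smul, Real.norm_eq_abs, abs_of_pos hcoef]
  have hμ0 : 0 < ‖μ‖ := by rw [hμn]; positivity
  set θ := ‖μ‖⁻¹ • μ with hθdef
  have hθ : ‖θ‖ = 1 := by rw [hθdef, norm_smul, norm_inv, norm_norm, inv_mul_cancel₀ hμ0.ne']
  set Q := rotSym p θ ‖μ‖ f with hQ
  have hQp : IsProbabilityMeasure Q := isProbabilityMeasure_rotSym hp hf μ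
  set Y : Sph p → ℝ := fun x => ⟪(x : Vec p), θ⟫
  have hY : Measurable Y := measurable_inner_sph θ
  have hYb : ∀ x, |Y x| ≤ 1 := fun x => (abs_inner_sph_le x θ).trans hθ.le
  have hYm : MemLp Y 2 Q := MemLp.of_bound hY.aestronglyMeasurable 1 (ae_of_all _ hYb)
  set m := ∫ x, Y x ∂Q
  have hm : C * min ‖μ‖ 1 ≤ m := H μ (norm_pos_iff.1 hμ0)
  have hmn : D ≤ √(n : ℝ) * m := by
    have e1 : D ≤ √(n : ℝ) * (C * min ‖μ‖ 1) := by
      have e2 : √(n : ℝ) * (C * min ‖μ‖ 1) = C * min (√(n : ℝ) * ‖μ‖) (√(n : ℝ)) := by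
        rw [mul_left_comm, mul_min_of_nonneg _ _ hsn.le, mul_one]
      have e3 : √(n : ℝ) * ‖μ‖ = √(p : ℝ) * ‖τ‖ := by
        rw [hμn, Real.sqrt_div hp0.le]
        field_simp
      rw [e2, e3, mul_comm, ← div_le_iff₀ hC]
      refine le_min (hτ.trans ?_) hnD
      exact le_mul_of_one_le_left hτ0.le hp1
    exact e1.trans (mul_le_mul_of_nonneg_left hm hsn.le)
  have hlaw : localLaw p n f τ = Measure.pi fun _ : Fin n => Q := rfl
  have hprob : IsProbabilityMeasure (localLaw p n f τ) := by rw [hlaw]; infer_instance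
  set S : Sample p n → ℝ := ∑ i, fun ω : Sample p n => Y (ω i)
  have hSm : MemLp S 2 (localLaw p n f τ) := by
    refine memLp_finsetSum' _ fun i _ => ?_
    exact hYm.comp_measurePreserving (measurePreserving_eval (fun _ : Fin n => Q) i)
  have hSE : ∫ x, S x ∂(localLaw p n f τ) = n * m := by
    simp only [S, Finset.sum_apply]
    rw [integral_finsetSum, hlaw]
    · have : ∀ i : Fin n, ∫ a, Y (a i) ∂(Measure.pi fun _ : Fin n => Q) = m := fun i =>
        integral_comp_eval (μ := fun _ : Fin n => Q) (i := i) hY.aestronglyMeasurable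
      simp [this]
    · intro i _
      exact (hYm.comp_measurePreserving
        (measurePreserving_eval (fun _ : Fin n => Q) i)).integrable one_le_two
  have hSV : Var[S; localLaw p n f τ] ≤ n := by
    rw [hlaw, variance_sum_pi (μ := fun _ : Fin n => Q) (X := fun _ => Y) fun _ => hYm]
    have : Var[Y; Q] ≤ 1 := by
      refine (variance_le_expectation_sq hY.aestronglyMeasurable).trans
        ((le_abs_self _).trans (abs_integral_le_of_abs_le fun x => ?_))
      rw [Pi.pow_apply, abs_pow]
      exact pow_le_one₀ (abs_nonneg _) (hYb x)
    simp only [Finset.sum_const, Finset.card_univ, Fintype.card_fin, nsmul_eq_mul]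
    exact mul_le_of_le_one_right hn0.le this
  have hSΔ : ∀ x : Sample p n, √((p : ℝ) / n) * S x = ⟪θ, centralSeq p n x⟫ := by
    intro x
    rw [← sum_inner_eq]
    simp only [S, Y, Finset.sum_apply, real_inner_smul_right, Finset.mul_sum]
  have hdev : ∀ x, rayleighTest p α n x = 0 → √(n : ℝ) * B ≤ |S x - n * m| := by
    intro x hx
    have hle : ‖centralSeq p n x‖ ≤ s := by
      rcases rayleighTest_cases hp h0 h1 n x with ⟨hx', -⟩ | ⟨-, hle⟩
      · rw [hx] at hx'; exact absurd hx' zero_ne_one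
      · exact hle
    have e1 : √((p : ℝ) / n) * S x ≤ s := by
      rw [hSΔ]
      refine (real_inner_le_norm _ _).trans ?_
      rwa [hθ, one_mul]
    have e2 : S x ≤ √(n : ℝ) * s := by
      by_contra! hcon
      have hsx : 0 ≤ S x := (by positivity : 0 ≤ √(n : ℝ) * s).trans hcon.le
      have e3 : √(p : ℝ) * S x ≤ √(n : ℝ) * s := by
        rw [Real.sqrt_div hp0.le, div_mul_eq_mul_div, div_le_iff₀ hsn] at e1
        linarith
      nlinarith
    have e4 : n * m = √(n : ℝ) * (√(n : ℝ) * m) := by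
      rw [← mul_assoc, Real.mul_self_sqrt hn0.le]
    have e5 : √(n : ℝ) * D ≤ n * m := by
      rw [e4]; exact mul_le_mul_of_nonneg_left hmn hsn.le
    refine le_trans ?_ (neg_le_abs _)
    simp only [D] at e5
    linarith
  have hcheb := meas_ge_le_variance_div_sq hSm (c := √(n : ℝ) * B) (by positivity)
  rw [hSE] at hcheb
  have hbound : Var[S; localLaw p n f τ] / (√(n : ℝ) * B) ^ 2 ≤ ε := by
    rw [div_le_iff₀ (by positivity), mul_pow, Real.sq_sqrt hn0.le]
    simp only [B]
    rw [div_pow, one_pow, Real.sq_sqrt hε.le]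
    field_simp
    exact hSV
  set E := {x : Sample p n | √(n : ℝ) * B ≤ |S x - n * m|}
  have hEm : MeasurableSet E := by
    have hS' : Measurable S := by
      have : S = fun x => ∑ i, Y (x i) := by ext x; simp [S]
      rw [this]
      exact Finset.measurable_fun_sum _ fun i _ => hY.comp (measurable_pi_apply i)
    exact measurableSet_le measurable_const (hS'.sub_const _).abs
  have hE : (localLaw p n f τ).real E ≤ ε := by
    rw [measureReal_def]
    refine ENNReal.toReal_le_of_le_ofReal hε.le (hcheb.trans (ENNReal.ofReal_le_ofReal hbound))
  have hφ := isTest_rayleighTest (p := p) α n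
  have hφi : Integrable (rayleighTest p α n) (localLaw p n f τ) :=
    Integrable.of_bound hφ.measurable.aestronglyMeasurable 1 (ae_of_all _ fun x => by
      rw [Real.norm_eq_abs, abs_of_nonneg (hφ.nonneg x)]; exact hφ.le_one x)
  have hfinal := integral_mono ((integrable_const (1 : ℝ)).sub
    ((integrable_const (1 : ℝ)).indicator hEm)) hφi (fun x => by
      simp only [Pi.sub_apply]
      by_cases hx : x ∈ E
      · rw [Set.indicator_of_mem hx, sub_self]; exact hφ.nonneg x
      · rw [Set.indicator_of_notMem hx, sub_zero]
        rcases rayleighTest_cases hp h0 h1 n x with ⟨hx', -⟩ | ⟨hx', -⟩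
        · exact hx'.ge
        · exact absurd (hdev x hx') hx)
  rw [integral_sub' (integrable_const _) ((integrable_const (1 : ℝ)).indicator hEm),
    integral_indicator hEm] at hfinal
  simp only [integral_const, probReal_univ, smul_eq_mul, mul_one,
    measureReal_restrict_apply_univ] at hfinal
  linarith

/-! ### Local asymptotic maximinity of the Rayleigh test -/

theorem minPower_le {n : ℕ} {A : Set (Vec p)} {τ : Vec p} (hτ : τ ∈ A) {φ : Sample p n → ℝ}
    (hφ : IsTest φ) : minPower (localLaw p n f) A φ ≤ ∫ x, φ x ∂(localLaw p n f τ) := by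
  refine ciInf_le (f := fun τ : A => ∫ x, φ x ∂(localLaw p n f τ)) ⟨0, ?_⟩ ⟨τ, hτ⟩
  rintro _ ⟨σ, rfl⟩
  exact integral_nonneg hφ.nonneg

theorem minPower_nonneg {n : ℕ} (A : Set (Vec p)) {φ : Sample p n → ℝ} (hφ : IsTest φ) :
    0 ≤ minPower (localLaw p n f) A φ :=
  Real.iInf_nonneg fun _ => integral_nonneg hφ.nonneg

theorem IsTest.abs_integral_le_one {Ω : Type*} [MeasurableSpace Ω] {P : Measure Ω}
    [IsProbabilityMeasure P] {φ : Ω → ℝ} (hφ : IsTest φ) : |∫ x, φ x ∂P| ≤ 1 :=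
  abs_integral_le_of_abs_le fun x => by rw [abs_of_nonneg (hφ.nonneg x)]; exact hφ.le_one x

theorem minPower_le_one (hp : 2 ≤ p) (hf : IsAngularFunction f) {n : ℕ} {A : Set (Vec p)}
    (hA : A.Nonempty) {φ : Sample p n → ℝ} (hφ : IsTest φ) :
    minPower (localLaw p n f) A φ ≤ 1 := by
  obtain ⟨τ, hτ⟩ := hA
  have : IsProbabilityMeasure (localLaw p n f τ) := isProbabilityMeasure_muLaw hp hf n _
  exact (minPower_le hτ hφ).trans ((le_abs_self _).trans hφ.abs_integral_le_one)

theorem mixPower_le_one_test (hp : 2 ≤ p) (e : Vec p) {n : ℕ} (t : ℝ) {φ : Sample p n → ℝ}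
    (hφ : IsTest φ) : mixPower e n t φ ≤ mixPower e n t (fun _ => 1) := by
  have hW := integrable_of_continuous hp (continuous_meanCosh_centralSeq hp e t n)
  refine mul_le_mul_of_nonneg_left ?_ (Real.exp_pos _).le
  refine integral_mono (integrable_mul_of_isTest hφ hW) (integrable_mul_of_isTest isTest_one hW)
    fun x => ?_
  exact mul_le_mul_of_nonneg_right (hφ.le_one x) (meanCosh_pos hp e _).le

theorem mixPower_nonneg (hp : 2 ≤ p) (e : Vec p) {n : ℕ} (t : ℝ) {φ : Sample p n → ℝ}
    (hφ : IsTest φ) : 0 ≤ mixPower e n t φ :=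
  mul_nonneg (Real.exp_pos _).le
    (integral_nonneg fun x => mul_nonneg (hφ.nonneg x) (meanCosh_pos hp e _).le)

/-- Least power is at most Bayes power under the uniform prior on the sphere of radius `c`, where
the Rayleigh test is optimal up to the discrepancy in size. -/
theorem eventually_minPower_le (hp : 2 ≤ p) (hf : IsAngularFunction f)
    (hf2 : TwiceDifferentiableAt f 0) {e : Vec p} (he : ‖e‖ = 1) {α : ℝ} (h0 : 0 < α) (h1 : α < 1)
    {c : ℝ} (hc : 0 < c) {A : Set (Vec p)} (hA : {τ | ‖τ‖ = c} ⊆ A) {β : ℝ}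
    (hβ : Tendsto (fun n => mixPower e n c (rayleighTest p α n)) atTop (𝓝 β))
    {ψ : ∀ n, Sample p n → ℝ} (hψ : HasAsymptoticLevel (fun n => nullLaw p n) α ψ)
    {ε : ℝ} (hε : 0 < ε) :
    ∀ᶠ n in atTop, minPower (localLaw p n f) A (ψ n) ≤ β + ε := by
  have := isProbabilityMeasure_nullLaw hp
  obtain ⟨hψt, hψl⟩ := hψ
  set K := Real.exp (-(1 / 2 * c ^ 2)) * meanCosh e (c * √(chiSqQuantile p (1 - α)))
  have hK : 0 < K := mul_pos (Real.exp_pos _) (meanCosh_pos hp e _)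
  -- One `δ` pays for the `L¹` approximation, one for the convergence to `β`, and `2Kδ` for a size
  -- excess of up to `2δ` over the Rayleigh test.
  set δ := ε / (2 + 2 * K)
  have hδ : 0 < δ := by positivity
  have hψe : ∀ᶠ n in atTop, ∫ x, ψ n x ∂(nullLaw p n) < α + δ := by
    refine eventually_lt_of_limsup_lt (hψl.trans_lt (by linarith)) ?_
    exact isBoundedUnder_of ⟨1, fun n =>
      (le_abs_self _).trans (hψt n).abs_integral_le_one⟩
  have hφe := (tendsto_integral_rayleighTest hp h0 h1).eventually (lt_mem_nhds (by linarith : α - δ < α))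
  have hbe := hβ.eventually (gt_mem_nhds (by linarith : β < β + δ))
  filter_upwards [hψe, hφe, hbe, eventually_integral_abs_lik_sub_le hp hf hf2 c hδ]
    with n e1 e2 e3 e4
  obtain ⟨τ, hτ, hτle⟩ := exists_integral_gaussLik_le hp he hc.le (hψt n)
  have a1 := minPower_le (f := f) (hA hτ) (hψt n)
  have a2 := (abs_le.1 (abs_integral_mul_lik_sub_le hp hf (e4 τ hτ.le) (hψt n))).2
  have a3 := integral_mul_meanCosh_le hp h0 h1 e hc.le (hψt n)
  have a4 : mixPower e n c (ψ n) ≤ mixPower e n c (rayleighTest p α n)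
      + K * (∫ x, ψ n x ∂(nullLaw p n) - ∫ x, rayleighTest p α n x ∂(nullLaw p n)) := by
    have := mul_le_mul_of_nonneg_left a3 (Real.exp_pos (-(1 / 2 * c ^ 2))).le
    rw [mul_add, ← mul_assoc] at this
    exact this
  have a5 : K * (∫ x, ψ n x ∂(nullLaw p n) - ∫ x, rayleighTest p α n x ∂(nullLaw p n))
      ≤ K * (2 * δ) := mul_le_mul_of_nonneg_left (by linarith) hK.le
  have a6 : δ * (2 + 2 * K) = ε := by simp only [δ]; field_simp
  linarith

theorem eventually_le_minPower_rayleighTest (hp : 2 ≤ p) (hf : IsAngularFunction f)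
    (hf2 : TwiceDifferentiableAt f 0) {e : Vec p} (he : ‖e‖ = 1) {α : ℝ} (h0 : 0 < α) (h1 : α < 1)
    {c : ℝ} (hc : 0 < c) {A : Set (Vec p)} (hA : A ⊆ {τ | c ≤ ‖τ‖}) (hne : A.Nonempty) {β : ℝ}
    (hβ : Tendsto (fun n => mixPower e n c (rayleighTest p α n)) atTop (𝓝 β))
    {ε : ℝ} (hε : 0 < ε) :
    ∀ᶠ n in atTop, β - ε ≤ minPower (localLaw p n f) A (rayleighTest p α n) := by
  have := hne.to_subtype
  set δ := min (ε / 4) (1 / 2)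
  have hδ : 0 < δ := by positivity
  have hδε : δ ≤ ε / 4 := min_le_left _ _
  have hδ2 : δ ≤ 1 / 2 := min_le_right _ _
  obtain ⟨M, hM⟩ := exists_integral_rayleighTest_ge hp hf h0 h1 hδ
  have hbe := hβ.eventually (lt_mem_nhds (by linarith : β - δ < β))
  filter_upwards [hM, hbe, eventually_integral_abs_lik_sub_le hp hf hf2 M hδ,
    eventually_abs_mixPower_one_sub_le hp hf hf2 he (max M c) hδ] with n e1 e2 e3 e4
  have hφ := isTest_rayleighTest (p := p) α n
  have hb0 := mixPower_nonneg hp e c hφ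
  have hb1 := mixPower_le_one_test hp e c hφ
  have hNc := abs_le.1 (e4 c hc.le (le_max_right _ _))
  have hpow := fun t (hct : c ≤ t) => mixPower_mul_le hp h0 h1 e (n := n) hc.le hct
  refine le_ciInf fun τ => ?_
  have hτ : c ≤ ‖(τ : Vec p)‖ := hA τ.2
  -- Remote alternatives have power at least `1 - δ`, which suffices since `β < 1 + 2δ` and `ε ≥
  -- 4δ`; the others are compared with radius `c`.
  rcases le_total M ‖(τ : Vec p)‖ with h | h
  · have := e1 τ h
    linarith
  · have a1 := (abs_le.1 (abs_integral_mul_lik_sub_le hp hf (e3 τ h) hφ)).1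
    rw [integral_gaussLik_eq_mixPower hp he hφ (rayleighTest_sampleRot α n)] at a1
    have hNt := abs_le.1 (e4 _ (norm_nonneg (τ : Vec p)) (h.trans (le_max_left _ _)))
    have hp' := hpow _ hτ
    set b := mixPower e n c (rayleighTest p α n)
    set Nc := mixPower e n c (fun _ => 1)
    set Nt := mixPower e n ‖(τ : Vec p)‖ (fun _ => 1)
    set a := mixPower e n ‖(τ : Vec p)‖ (rayleighTest p α n)
    have ha0 : 0 ≤ a := mixPower_nonneg hp e _ hφ
    have a2 : b * (1 - δ) ≤ a * (1 + δ) :=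
      (mul_le_mul_of_nonneg_left (by linarith) hb0).trans
        (hp'.trans (mul_le_mul_of_nonneg_left (by linarith) ha0))
    -- `(b - 2δ)(1 + δ) ≤ b(1 - δ)` amounts to `b ≤ 1 + δ`, which holds because `b ≤ Nc`.
    have a3 : (b - 2 * δ) * (1 + δ) ≤ a * (1 + δ) := by
      nlinarith
    have a4 : b - 2 * δ ≤ a := le_of_mul_le_mul_right a3 (by linarith)
    linarith

theorem isLocallyAsymptoticallyMaximin_rayleighTest (hp : 2 ≤ p) (hf : IsAngularFunction f)
    (hf2 : TwiceDifferentiableAt f 0) {α : ℝ} (h0 : 0 < α) (h1 : α < 1) :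
    IsLocallyAsymptoticallyMaximin (fun n => nullLaw p n) (fun n => localLaw p n f) α
      (rayleighTest p α) := by
  refine ⟨⟨isTest_rayleighTest α, (tendsto_integral_rayleighTest hp h0 h1).limsup_eq.le⟩,
    fun c hc A hA hA' ψ hψ => ?_⟩
  obtain ⟨e, he⟩ := exists_norm_eq hp zero_le_one
  have hne : A.Nonempty := (exists_norm_eq hp hc.le).imp fun τ hτ => hA hτ
  obtain ⟨β, hβ⟩ := exists_tendsto_mixPower_rayleighTest hp hf hf2 he h0 h1 hc.le
  have hle : limsup (fun n => minPower (localLaw p n f) A (ψ n)) atTop ≤ β :=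
    le_of_forall_pos_le_add fun ε hε => limsup_le_of_le
      (isBoundedUnder_of ⟨0, fun n => minPower_nonneg A (hψ.1 n)⟩ :
        IsBoundedUnder (· ≥ ·) atTop _).isCoboundedUnder_le
      (eventually_minPower_le hp hf hf2 he h0 h1 hc hA hβ hψ hε)
  have hge : β ≤ liminf (fun n => minPower (localLaw p n f) A (rayleighTest p α n)) atTop :=
    le_of_forall_sub_le fun ε hε => le_liminf_of_le
      (isBoundedUnder_of ⟨1, fun n => minPower_le_one hp hf hne (isTest_rayleighTest α n)⟩ :
        IsBoundedUnder (· ≤ ·) atTop _).isCoboundedUnder_ge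
      (eventually_le_minPower_rayleighTest hp hf hf2 he h0 h1 hc hA' hne hβ hε)
  exact hle.trans hge

end SphereUniformity

end

theorem theorem4p1 (p : ℕ) (hp : 2 ≤ p) (f : ℝ → ℝ)
    (hf : SphereUniformity.IsAngularFunction f)
    (hf2 : SphereUniformity.TwiceDifferentiableAt f 0) :
    -- local asymptotic normality
    (∀ τ : ℕ → SphereUniformity.Vec p,
      τ =O[atTop] (fun _ => (1 : ℝ)) → ¬ τ =o[atTop] (fun _ => (1 : ℝ)) →
      SphereUniformity.IsLittleOP (fun n => SphereUniformity.nullLaw p n)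
        (fun n x =>
          llr (SphereUniformity.muLaw p n (√((p : ℝ) / n) • τ n) f)
              (SphereUniformity.nullLaw p n) x
            - (⟪τ n, SphereUniformity.centralSeq p n x⟫ - 1 / 2 * ‖τ n‖ ^ 2))) ∧
    -- asymptotic normality of the central sequence under the null
    (haveI := SphereUniformity.isProbabilityMeasure_nullLaw hp
     TendstoInDistribution (fun n => SphereUniformity.centralSeq p n) atTop
        (id : SphereUniformity.Vec p → SphereUniformity.Vec p)
        (fun n => SphereUniformity.nullLaw p n)
        (stdGaussian (SphereUniformity.Vec p))) ∧
    -- local asymptotic maximinity of the Rayleigh test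
    (∀ α : ℝ, 0 < α → α < 1 →
      SphereUniformity.IsLocallyAsymptoticallyMaximin
        (fun n => SphereUniformity.nullLaw p n)
        (fun n => SphereUniformity.localLaw p n f)
        α (SphereUniformity.rayleighTest p α)) :=
  ⟨fun _ hτ _ => SphereUniformity.isLittleOP_llr hp hf hf2 hτ,
    SphereUniformity.tendstoInDistribution_centralSeq hp,
    fun _ h0 h1 => SphereUniformity.isLocallyAsymptoticallyMaximin_rayleighTest hp hf hf2 h0 h1⟩
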